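/- Let $\mathfrak{o}$ be a complete discrete valuation ring with finite residue field of cardinality $q$, and let $\mathfrak{O}_1,\dots,\mathfrak{O}_h$ be finite extensions of $\mathfrak{o}$, that is, discrete valuation rings containing $\mathfrak{o}$ that are finitely generated as $\mathfrak{o}$-modules. Let $\mathfrak{M}_i$ be the maximal ideal, $e_i$ the ramification index and $f_i$ the inertia degree of $\mathfrak{O}_i$ over $\mathfrak{o}$, and put $q_i=q^{f_i}$. Let $n_1,\dots,n_h\ge 0$ be integers, $n=\sum_{i=1}^h e_if_in_i$ and $$\Omega=\mathfrak{O}_1^{n_1}\times\cdots\times\mathfrak{O}_h^{n_h}\cong\mathfrak{o}^n ,$$ with projections $\pi_i:\Omega\to\mathfrak{O}_i^{n_i}$. A partition with $N$ parts is a sequence $\nu_1\ge\dots\ge\nu_N\ge 0$ of integers. The elementary divisor type of a finite-index $\mathfrak{O}_i$-submodule $H$ of $\mathfrak{O}_i^{n_i}$ is the partition $\nu$ with $n_i$ parts such that $\mathfrak{O}_i^{n_i}/H\cong\prod_{j=1}^{n_i}\mathfrak{O}_i/\mathfrak{M}_i^{\nu_j}$. For an $\mathfrak{o}$-submodule $\Lambda\le\Omega$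 of finite index, its projection data $\boldsymbol{\nu}(\Lambda)$ is the $h$-tuple whose $i$-th entry is the elementary divisor type of the $\mathfrak{O}_i$-submodule of $\mathfrak{O}_i^{n_i}$ generated by $\pi_i(\Lambda)$. For a partition $\nu$ with $N$ parts put $J_\nu=\{d\in\{1,\dots,N-1\}\mid \nu_d>\nu_{d+1}\}$ and $$\beta(\nu;Y)=\binom{N}{J_\nu}_{Y^{-1}}\,Y^{\sum_{d=1}^{N-1}d(N-d)(\nu_d-\nu_{d+1})},$$ where $\binom{N}{J}_Y=\binom{N}{j_r}_Y\binom{j_r}{j_{r-1}}_Y\cdots\binom{j_2}{j_1}_Y$ for $J=\{j_1<\dots<j_r\}$ (equal to $1$ if $J=\varnothing$) and $\binom{a}{b}_Y=\prod_{i=a-b+1}^{a}(1-Y^i)\big/\prod_{i=1}^{b}(1-Y^i)$. Write $t=q^{-s}$ for $s\in\mathbb{C}$. For $R\in\{\mathfrak{o},\mathfrak{O}_1,\dots,\mathfrak{O}_h\}$ and $N\ge 0$ let $\zeta_{R^N}(s)=\sum_{H}|R^N:H|^{-s}$, where $H$ runs over the $R$-submodules of finite index of $R^N$. Let $\widetilde{\boldsymbol{\nu}}=(\nu^{(1)},\dots,\nu^{(h)})$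 be a family of partitions, where $\nu^{(i)}$ has $n_i$ parts, and let $s\in\mathbb{C}$ with $\operatorname{Re}(s)>n-1$. Then the series $\zeta_{\mathfrak{o}^n}(s)$ and $\zeta_{\mathfrak{O}_i^{n_i}}(s)$, $i=1,\dots,h$, converge absolutely, $\zeta_{\mathfrak{O}_i^{n_i}}(s)\neq 0$ for all $i$, and the following series over the $\mathfrak{o}$-submodules $\Lambda\le\Omega$ of finite index with projection data $\widetilde{\boldsymbol{\nu}}$ converges absolutely, with $$\sum_{\substack{\Lambda\le\Omega\\ \boldsymbol{\nu}(\Lambda)=\widetilde{\boldsymbol{\nu}}}}|\Omega:\Lambda|^{-s}=\frac{\zeta_{\mathfrak{o}^n}(s)}{\prod_{i=1}^h\zeta_{\mathfrak{O}_i^{n_i}}(s)}\left(\prod_{i=1}^h\beta(\nu^{(i)};q_i)\right)t^{\sum_{i=1}^h\left(\sum_{j=1}^{n_i}\nu^{(i)}_j\right)f_i}.$$ -/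

import Mathlib

noncomputable section

namespace LatticeCount

/-- The Gaussian binomial `∏_{i=a-b+1}^{a} (1 - Y^i) / ∏_{i=1}^{b} (1 - Y^i)` for `b ≤ a`,
evaluated at an element `Y` of a field at which the denominator does not vanish
(for instance at `Y = 1/q` with `q ≥ 2` an integer). -/
def gaussBinom {K : Type*} [Field K] (a b : ℕ) (Y : K) : K :=
  (∏ i ∈ Finset.Icc (a - b + 1) a, (1 - Y ^ i)) / ∏ i ∈ Finset.Icc 1 b, (1 - Y ^ i)

/-- The Gaussian multinomial of `N` and `J = {j₁ < ⋯ < jᵣ} ⊆ [N - 1]`, i.e. the product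
`gaussBinom N jᵣ * gaussBinom jᵣ jᵣ₋₁ * ⋯ * gaussBinom j₂ j₁`. -/
def gaussMultinom {K : Type*} [Field K] (N : ℕ) (J : Finset ℕ) (Y : K) : K :=
  (List.zipWith (fun a b => gaussBinom a b Y)
    (N :: J.sort (fun a b => b ≤ a)) (J.sort (fun a b => b ≤ a))).prod

/-- The `d`-th part, `1 ≤ d ≤ N`, of a partition with `N` parts; the indices of parts start at
`1` here, whereas `Fin N` starts at `0`. -/
def part {N : ℕ} (ν : Fin N → ℕ) (d : ℕ) : ℕ :=
  if h : d - 1 < N then ν ⟨d - 1, h⟩ else 0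

/-- `J_ν = {d ∈ [N - 1] | ν_d > ν_{d+1}}`. -/
def jumps {N : ℕ} (ν : Fin N → ℕ) : Finset ℕ :=
  (Finset.Ico 1 N).filter (fun d => part ν (d + 1) < part ν d)

/-- `β(ν; Y)`: the Gaussian multinomial of `N` and `J_ν` at `Y⁻¹`, times `Y` to the power
`∑_{d=1}^{N-1} d (N - d) (ν_d - ν_{d+1})`. -/
def beta {K : Type*} [Field K] {N : ℕ} (ν : Fin N → ℕ) (Y : K) : K :=
  gaussMultinom N (jumps ν) Y⁻¹ *
    Y ^ (∑ d ∈ Finset.Ico 1 N, d * (N - d) * (part ν d - part ν (d + 1)))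

/-- The `R`-submodules of finite index of an `R`-module `M`. -/
abbrev FinIndexSubmodule (R M : Type*) [CommRing R] [AddCommGroup M] [Module R M] : Type _ :=
  {Λ : Submodule R M // Finite (M ⧸ Λ)}

/-- The term `|M : Λ|^{-s}`. -/
def indexTerm {R M : Type*} [CommRing R] [AddCommGroup M] [Module R M]
    (s : ℂ) (Λ : Submodule R M) : ℂ :=
  (Nat.card (M ⧸ Λ) : ℂ) ^ (-s)

/-- `ζ_M(s) = ∑_Λ |M : Λ|^{-s}`, over all `R`-submodules `Λ` of `M` of finite index. -/
def latticeZeta (R M : Type*) [CommRing R] [AddCommGroup M] [Module R M] (s : ℂ) : ℂ :=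
  ∑' Λ : FinIndexSubmodule R M, indexTerm s Λ.1

/-- The partition `ν` with `N` parts is the elementary divisor type of the `R`-submodule `H` of
`R^N`, where `R` is a local ring with maximal ideal `𝔐`:
`R^N / H ≃ R / 𝔐^{ν_1} × ⋯ × R / 𝔐^{ν_N}`. -/
def IsElemDivType {R : Type*} [CommRing R] [IsLocalRing R] {N : ℕ}
    (H : Submodule R (Fin N → R)) (ν : Fin N → ℕ) : Prop :=
  Antitone ν ∧
    Nonempty (((Fin N → R) ⧸ H) ≃ₗ[R] (Π j, R ⧸ IsLocalRing.maximalIdeal R ^ ν j))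

section Projections

variable (𝔬 : Type*) [CommRing 𝔬] {h : ℕ} (𝔒 : Fin h → Type*)
  [∀ i, CommRing (𝔒 i)] [∀ i, Algebra 𝔬 (𝔒 i)] (n : Fin h → ℕ)

/-- `Ω = 𝔒_1^{n_1} × ⋯ × 𝔒_h^{n_h}`. -/
abbrev Omega : Type _ := Π i, (Fin (n i) → 𝔒 i)

variable {𝔬 𝔒 n}

/-- The `𝔒_i`-submodule of `𝔒_i^{n_i}` generated by the projection `π_i(Λ)`. -/
def projSpan (Λ : Submodule 𝔬 (Omega 𝔒 n)) (i : Fin h) : Submodule (𝔒 i) (Fin (n i) → 𝔒 i) :=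
  Submodule.span (𝔒 i) ((fun x : Omega 𝔒 n => x i) '' (Λ : Set (Omega 𝔒 n)))

/-- The family `ν` is the projection data of `Λ`. -/
def IsProjectionData [∀ i, IsLocalRing (𝔒 i)] (Λ : Submodule 𝔬 (Omega 𝔒 n))
    (ν : (i : Fin h) → Fin (n i) → ℕ) : Prop :=
  ∀ i, IsElemDivType (projSpan Λ i) (ν i)

end Projections

section Extensions

/-- The cardinality `q` of the residue field of `𝔬`. -/
def resCard (𝔬 : Type*) [CommRing 𝔬] [IsLocalRing 𝔬] : ℕ := Nat.card (IsLocalRing.ResidueField 𝔬)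

variable (𝔬 : Type*) [CommRing 𝔬] (𝔓 : Type*) [CommRing 𝔓] [IsLocalRing 𝔓] [Algebra 𝔬 𝔓]

/-- The ramification index of the extension `𝔓` of `𝔬`. -/
def ramIdx : ℕ :=
  (IsLocalRing.maximalIdeal 𝔓).ramificationIdx 𝔬

/-- The inertia degree of the extension `𝔓` of `𝔬`. -/
def inertDeg : ℕ :=
  (IsLocalRing.maximalIdeal 𝔓).inertiaDeg 𝔬

end Extensions

end LatticeCount

end

/-! Send a sublattice Λ of Ω to the family H of the submodules H_i generated by its projections.
Each H_i has finite index in a free module over a discrete valuation ring, so it is the image of an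
injective 𝔒_i-linear endomorphism g_i of 𝔒_i^{n_i}. The product of the g_i carries the full
sublattices (those whose projections generate everything) bijectively onto the sublattices with data
H, and multiplies the index by ∏ |𝔒_i^{n_i} : H_i| (`exists_fiberEquiv`). Hence, for every condition
P on H, the sum over the Λ with P(H) is the sum over these H of ∏ |𝔒_i^{n_i} : H_i|^{-s}, times a
factor Z independent of P: the sum over the full sublattices (`hasSum_of_projSpans`).

With P always true and Ω ≅ 𝔬^n, this gives ζ_{𝔬^n} = Z · ∏ ζ_{𝔒_i^{n_i}}, which determines Z. With P
prescribing the types ν^{(i)}, it remains to count the H of type ν in R^N, all of which have index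
q^{|ν|}. Their number is β(ν; q) (`card_isElemDivType`): it is the number of surjections from R^N
onto M_ν = ∏ R/𝔐^{ν_j}, divided by |Aut M_ν|. By Nakayama both counts become linear algebra over the
residue field: spanning tuples for the surjections, and independent families subordinate to a flag
of coordinate subspaces for the automorphisms.

Convergence and non-vanishing come from ζ_{R^N}(s) = ∏_{i<N} (1 - q^{i-s})⁻¹
(`summable_and_hasSum_indexTerm`), proved by splitting off one coordinate at a time. -/

open Module

namespace LatticeCount

/-! ### Indices of submodules -/

section Index

variable {R M M' : Type*} [CommRing R] [AddCommGroup M] [Module R M] [AddCommGroup M'] [Module R M']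

theorem finite_quotient_iff (Λ : Submodule R M) : Finite (M ⧸ Λ) ↔ Nat.card (M ⧸ Λ) ≠ 0 := by
  have : Nonempty (M ⧸ Λ) := ⟨0⟩
  simp [Nat.card_ne_zero, this]

theorem indexTerm_eq_mul {M'' : Type*} [AddCommGroup M''] [Module R M''] (s : ℂ)
    {Λ : Submodule R M} {Λ' : Submodule R M'} {Λ'' : Submodule R M''}
    (h : Nat.card (M ⧸ Λ) = Nat.card (M' ⧸ Λ') * Nat.card (M'' ⧸ Λ'')) :
    indexTerm s Λ = indexTerm s Λ' * indexTerm s Λ'' := by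
  rw [indexTerm, h, Nat.cast_mul, Complex.natCast_mul_natCast_cpow, indexTerm, indexTerm]

theorem natCast_pow_cpow (q k : ℕ) (z : ℂ) : ((q : ℂ) ^ k) ^ z = ((q : ℂ) ^ z) ^ k := by
  rw [← Complex.natCast_cpow_natCast_mul, Complex.cpow_nat_mul]

theorem card_quotient_map {f : M →ₗ[R] M'} (hf : Function.Injective f) (Λ : Submodule R M) :
    Nat.card (M' ⧸ Λ.map f) = Nat.card (M ⧸ Λ) * Nat.card (M' ⧸ LinearMap.range f) :=
  AddSubgroup.index_map_of_injective Λ.toAddSubgroup (f := f.toAddMonoidHom) hf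

/-- The index is multiplicative along H ≤ M' + H ≤ M × M': the upper step is the index of the
projection of H to M, the lower one the index of H ∩ M' in M'. -/
theorem card_quotient_prod (H : Submodule R (M × M')) :
    Nat.card ((M × M') ⧸ H) = Nat.card (M ⧸ H.map (LinearMap.fst R M M')) *
      Nat.card (M' ⧸ H.comap (LinearMap.inr R M M')) := by
  have hsurj : Function.Surjective (LinearMap.fst R M M').toAddMonoidHom := fun x => ⟨(x, 0), rfl⟩
  have h1 := AddSubgroup.index_comap_of_surjective
    (H.map (LinearMap.fst R M M')).toAddSubgroup hsurj
  have h2 : (H.map (LinearMap.fst R M M')).toAddSubgroup.comap (LinearMap.fst R M M').toAddMonoidHom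
      = (LinearMap.inr R M M').toAddMonoidHom.range ⊔ H.toAddSubgroup := by
    ext ⟨x, y⟩
    simp only [AddSubgroup.mem_comap, AddSubgroup.mem_sup]
    constructor
    · rintro ⟨⟨x', y'⟩, hz, hx⟩
      obtain rfl : x' = x := hx
      exact ⟨(0, y - y'), ⟨y - y', rfl⟩, (x', y'), hz, by simp⟩
    · rintro ⟨_, ⟨z, rfl⟩, ⟨x', y'⟩, hz, hx⟩
      refine ⟨(x', y'), hz, ?_⟩
      have := congrArg Prod.fst hx
      simpa using this
  have h3 := AddSubgroup.index_comap H.toAddSubgroup (LinearMap.inr R M M').toAddMonoidHom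
  have h4 := AddSubgroup.relIndex_mul_index
    (le_sup_right : H.toAddSubgroup ≤ (LinearMap.inr R M M').toAddMonoidHom.range ⊔ _)
  rw [AddSubgroup.relIndex_sup_right, ← h2, h1, ← h3] at h4
  rw [mul_comm]
  exact h4.symm

/-- A linear equivalence induces a bijection between the submodules of finite index. -/
def finIndexSubmoduleCongr (e : M ≃ₗ[R] M') : FinIndexSubmodule R M ≃ FinIndexSubmodule R M' :=
  (Submodule.orderIsoMapComap e).toEquiv.subtypeEquiv fun Λ =>
    (Submodule.Quotient.equiv Λ (Λ.map (e : M →ₗ[R] M')) e rfl).toEquiv.finite_iff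

theorem indexTerm_finIndexSubmoduleCongr (e : M ≃ₗ[R] M') (s : ℂ) (Λ : FinIndexSubmodule R M) :
    indexTerm s (finIndexSubmoduleCongr e Λ).1 = indexTerm s Λ.1 := by
  have := Nat.card_congr
    (Submodule.Quotient.equiv Λ.1 (Λ.1.map (e : M →ₗ[R] M')) e rfl).toEquiv
  rw [indexTerm, indexTerm, this]
  rfl

end Index

/-! ### Submodules of a product as graphs of homomorphisms -/

section Goursat

variable {R M M' : Type*} [CommRing R] [AddCommGroup M] [Module R M] [AddCommGroup M'] [Module R M']

/-- The submodule of `M × M'` of all `(x, y)` with `x ∈ H` and `φ x = y` modulo `I`. -/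
def graphMod {H : Submodule R M} {I : Submodule R M'} (φ : H →ₗ[R] M' ⧸ I) :
    Submodule R (M × M') :=
  (LinearMap.ker (φ.comp (LinearMap.fst R H M') - I.mkQ.comp (LinearMap.snd R H M'))).map
    (H.subtype.prodMap LinearMap.id)

theorem mem_graphMod {H : Submodule R M} {I : Submodule R M'} (φ : H →ₗ[R] M' ⧸ I) (z : M × M') :
    z ∈ graphMod φ ↔ ∃ hx : z.1 ∈ H, φ ⟨z.1, hx⟩ = I.mkQ z.2 := by
  obtain ⟨x, y⟩ := z
  constructor
  · rintro ⟨⟨⟨x', hx'⟩, y'⟩, hz, he⟩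
    obtain ⟨rfl, rfl⟩ : x' = x ∧ y' = y := by simpa using he
    exact ⟨hx', sub_eq_zero.1 (by simpa using hz)⟩
  · rintro ⟨hx, h⟩
    exact ⟨(⟨x, hx⟩, y), by simpa using sub_eq_zero.2 h, rfl⟩

theorem map_fst_graphMod {H : Submodule R M} {I : Submodule R M'} (φ : H →ₗ[R] M' ⧸ I) :
    (graphMod φ).map (LinearMap.fst R M M') = H := by
  ext x
  simp only [Submodule.mem_map, mem_graphMod]
  constructor
  · rintro ⟨z, ⟨hz, -⟩, rfl⟩
    exact hz
  · intro hx
    obtain ⟨y, hy⟩ := I.mkQ_surjective (φ ⟨x, hx⟩)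
    exact ⟨(x, y), ⟨hx, hy.symm⟩, rfl⟩

theorem comap_inr_graphMod {H : Submodule R M} {I : Submodule R M'} (φ : H →ₗ[R] M' ⧸ I) :
    (graphMod φ).comap (LinearMap.inr R M M') = I := by
  ext y
  simp only [Submodule.mem_comap, mem_graphMod, LinearMap.inr_apply]
  have h0 : φ ⟨0, H.zero_mem⟩ = 0 := map_zero φ
  constructor
  · rintro ⟨_, h⟩
    rw [h0] at h
    simpa using h.symm
  · intro hy
    refine ⟨H.zero_mem, ?_⟩
    rw [h0, eq_comm]
    simpa using hy

/-- If K projects onto H and meets M' in I, the y with (x, y) ∈ K form a single coset of I for each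
x ∈ H, and this coset depends linearly on x. -/
theorem graphMod_bijective (H : Submodule R M) (I : Submodule R M') :
    Function.Bijective (fun φ : H →ₗ[R] M' ⧸ I => (⟨graphMod φ, map_fst_graphMod φ,
      comap_inr_graphMod φ⟩ : {K : Submodule R (M × M') // K.map (LinearMap.fst R M M') = H ∧
        K.comap (LinearMap.inr R M M') = I})) := by
  constructor
  · intro φ ψ h
    have h' : graphMod φ = graphMod ψ := congrArg Subtype.val h
    ext ⟨x, hx⟩
    obtain ⟨y, hy⟩ := I.mkQ_surjective (φ ⟨x, hx⟩)
    have : (x, y) ∈ graphMod φ := (mem_graphMod φ _).2 ⟨hx, hy.symm⟩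
    rw [h', mem_graphMod] at this
    obtain ⟨_, h2⟩ := this
    rw [← hy, ← h2]
  · rintro ⟨K, rfl, rfl⟩
    have hex : ∀ x : K.map (LinearMap.fst R M M'), ∃ y, ((x : M), y) ∈ K := by
      rintro ⟨_, ⟨⟨x, y⟩, hz, rfl⟩⟩
      exact ⟨y, hz⟩
    choose g hg using hex
    have key : ∀ (x : K.map (LinearMap.fst R M M')) (y : M'), ((x : M), y) ∈ K ↔
        (K.comap (LinearMap.inr R M M')).mkQ (g x) = (K.comap (LinearMap.inr R M M')).mkQ y := by
      intro x y
      rw [Submodule.mkQ_apply, Submodule.mkQ_apply, Submodule.Quotient.eq, Submodule.mem_comap]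
      constructor
      · intro h
        have := K.sub_mem (hg x) h
        simpa using this
      · intro h
        have := K.sub_mem (hg x) h
        simpa using this
    refine ⟨{ toFun := fun x => (K.comap (LinearMap.inr R M M')).mkQ (g x), map_add' := ?_,
              map_smul' := ?_ }, ?_⟩
    · intro x y
      rw [← map_add, ← key]
      exact K.add_mem (hg x) (hg y)
    · intro c x
      rw [← map_smul, ← key]
      exact K.smul_mem c (hg x)
    · ext ⟨x, y⟩
      simp only [mem_graphMod, LinearMap.coe_mk, AddHom.coe_mk]
      constructor
      · rintro ⟨hx, h⟩
        exact (key ⟨x, hx⟩ y).2 h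
      · intro h
        have hx : x ∈ K.map (LinearMap.fst R M M') := ⟨(x, y), h, rfl⟩
        exact ⟨hx, (key ⟨x, hx⟩ y).1 h⟩

end Goursat

/-! ### Summation over finite fibres -/

section Sums

/-- Summation over the fibres of a map with finite fibres of a function which is constant on the
fibres. -/
theorem hasSum_of_fibers {X Y : Type*} (p : X → Y) (f : X → ℂ) (g : Y → ℂ) (c : Y → ℕ)
    (hfin : ∀ y, Finite {x // p x = y}) (hc : ∀ y, Nat.card {x // p x = y} = c y)
    (hf : ∀ x, f x = g (p x)) {a : ℂ} (hs : Summable fun y => (c y : ℝ) * ‖g y‖)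
    (ha : HasSum (fun y => (c y : ℂ) * g y) a) :
    (Summable fun x => ‖f x‖) ∧ HasSum f a := by
  have h1 : Summable fun x => ‖f x‖ := by
    rw [← (Equiv.sigmaFiberEquiv p).summable_iff,
      summable_sigma_of_nonneg fun _ => by simp]
    refine ⟨fun y => ?_, ?_⟩
    · have := hfin y
      exact Summable.of_finite
    · convert! hs with y
      have := Fintype.ofFinite {x // p x = y}
      rw [tsum_fintype, ← hc, Nat.card_eq_fintype_card, ← nsmul_eq_mul, ← Finset.card_univ,
        ← Finset.sum_const]
      refine Finset.sum_congr rfl fun x _ => ?_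
      obtain ⟨x, rfl⟩ := x
      simp [hf, Equiv.sigmaFiberEquiv]
  refine ⟨h1, ?_⟩
  rw [← (Equiv.sigmaFiberEquiv p).hasSum_iff]
  refine HasSum.sigma_of_hasSum ha (fun y => ?_)
    ((Equiv.sigmaFiberEquiv p).summable_iff.2 h1.of_norm)
  have := Fintype.ofFinite {x // p x = y}
  convert! hasSum_fintype _
  rw [← hc, Nat.card_eq_fintype_card, ← nsmul_eq_mul, ← Finset.card_univ, ← Finset.sum_const]
  refine Finset.sum_congr rfl fun x _ => ?_
  obtain ⟨x, rfl⟩ := x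
  simp [hf, Equiv.sigmaFiberEquiv]

end Sums

/-! ### The zeta function of R^N over a discrete valuation ring -/

section Zeta

variable (R : Type*) [CommRing R] [IsDomain R] [IsDiscreteValuationRing R]

theorem one_lt_resCard [Finite (IsLocalRing.ResidueField R)] : 1 < resCard R :=
  Finite.one_lt_card

theorem card_quotient_maximalIdeal_pow (k : ℕ) :
    Nat.card (R ⧸ IsLocalRing.maximalIdeal R ^ k) = resCard R ^ k :=
  cardQuot_pow_of_prime (IsDiscreteValuationRing.not_a_field R)

theorem infinite_of_isDiscreteValuationRing (R : Type*) [CommRing R] [IsDomain R]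
    [IsDiscreteValuationRing R] : Infinite R := by
  by_contra h
  rw [not_infinite_iff_finite] at h
  exact IsDiscreteValuationRing.not_isField R (Finite.isField_of_domain R)

/-- R is infinite, so every element of the finite quotient is torsion and the quotient has rank 0.
Thus H has rank N, and it is free because R is a principal ideal domain. -/
theorem exists_linearEquiv_of_finite_quotient {N : ℕ} (H : Submodule R (Fin N → R))
    [Finite ((Fin N → R) ⧸ H)] : Nonempty ((Fin N → R) ≃ₗ[R] H) := by
  have hinf := infinite_of_isDiscreteValuationRing R
  have h0 : Module.finrank R ((Fin N → R) ⧸ H) = 0 := by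
    rw [Module.finrank_eq_zero_iff]
    intro x
    by_contra! hx
    refine not_injective_infinite_finite (fun r : R => r • x) fun a b hab => ?_
    by_contra hne
    exact hx (a - b) (sub_ne_zero.2 hne) (by simpa [sub_smul, sub_eq_zero] using hab)
  have h1 := Submodule.finrank_quotient_add_finrank H
  exact ⟨LinearEquiv.ofFinrankEq _ _ (by rw [← h1, h0, zero_add])⟩

theorem card_linearMap_of_finite_quotient {N : ℕ} (H : Submodule R (Fin N → R))
    [Finite ((Fin N → R) ⧸ H)] (Q : Type*) [AddCommGroup Q] [Module R Q] :
    Nat.card (H →ₗ[R] Q) = Nat.card Q ^ N := by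
  obtain ⟨e⟩ := exists_linearEquiv_of_finite_quotient R H
  rw [← Nat.card_congr ((LinearEquiv.arrowCongr e (LinearEquiv.refl R Q)).toEquiv),
    ← Nat.card_congr ((Pi.basisFun R (Fin N)).constr R (M' := Q)).toEquiv, Nat.card_fun,
    Nat.card_fin]

variable [Finite (IsLocalRing.ResidueField R)]

/-- The ideals of finite index are the powers of the maximal ideal. -/
theorem maximalIdeal_pow_bijective : Function.Bijective (fun k : ℕ =>
    (⟨IsLocalRing.maximalIdeal R ^ k, (finite_quotient_iff _).2 (by
      rw [card_quotient_maximalIdeal_pow]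
      exact pow_ne_zero _ (one_lt_resCard R).ne_bot)⟩ : FinIndexSubmodule R R)) := by
  constructor
  · intro k l h
    have h' : IsLocalRing.maximalIdeal R ^ k = IsLocalRing.maximalIdeal R ^ l :=
      congrArg Subtype.val h
    have h2 := card_quotient_maximalIdeal_pow R k
    rw [h', card_quotient_maximalIdeal_pow] at h2
    exact (Nat.pow_right_injective (one_lt_resCard R) h2).symm
  · rintro ⟨I, hI⟩
    obtain ⟨ϖ, hϖ⟩ := IsDiscreteValuationRing.exists_irreducible R
    have hI0 : I ≠ ⊥ := by
      rintro rfl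
      have := infinite_of_isDiscreteValuationRing R
      have := Finite.of_equiv _ (Submodule.quotEquivOfEqBot (⊥ : Ideal R) rfl).toEquiv
      exact not_finite R
    obtain ⟨k, hk⟩ := IsDiscreteValuationRing.ideal_eq_span_pow_irreducible hI0 hϖ
    refine ⟨k, Subtype.ext ?_⟩
    change IsLocalRing.maximalIdeal R ^ k = I
    rw [hk, hϖ.maximalIdeal_eq, Ideal.span_singleton_pow]

variable {R}

/-- The pair consisting of the projection to the first factor and the intersection with the second
factor. -/
def fstInr {M M' : Type*} [AddCommGroup M] [Module R M] [AddCommGroup M'] [Module R M']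
    (K : FinIndexSubmodule R (M × M')) : FinIndexSubmodule R M × FinIndexSubmodule R M' :=
  (⟨K.1.map (LinearMap.fst R M M'), (finite_quotient_iff _).2 (by
      have := (finite_quotient_iff _).1 K.2
      rw [card_quotient_prod] at this
      exact left_ne_zero_of_mul this)⟩,
   ⟨K.1.comap (LinearMap.inr R M M'), (finite_quotient_iff _).2 (by
      have := (finite_quotient_iff _).1 K.2
      rw [card_quotient_prod] at this
      exact right_ne_zero_of_mul this)⟩)

/-- Fibres of `fstInr` are spaces of homomorphisms. -/
noncomputable def fstInrFiberEquiv {M M' : Type*} [AddCommGroup M] [Module R M]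
    [AddCommGroup M'] [Module R M']
    (y : FinIndexSubmodule R M × FinIndexSubmodule R M') :
    {K : FinIndexSubmodule R (M × M') // fstInr K = y} ≃ (y.1.1 →ₗ[R] M' ⧸ y.2.1) :=
  (Equiv.trans
    { toFun := fun K => ⟨K.1.1, congrArg (fun z => z.1.1) K.2, congrArg (fun z => z.2.1) K.2⟩
      invFun := fun K => ⟨⟨K.1, (finite_quotient_iff _).2 (by
        rw [card_quotient_prod, K.2.1, K.2.2]
        exact mul_ne_zero ((finite_quotient_iff _).1 y.1.2) ((finite_quotient_iff _).1 y.2.2))⟩,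
        Prod.ext (Subtype.ext K.2.1) (Subtype.ext K.2.2)⟩
      left_inv := fun _ => rfl
      right_inv := fun _ => rfl }
    (Equiv.ofBijective _ (graphMod_bijective y.1.1 y.2.1)).symm)

variable (R)

theorem norm_resCard_pow_mul_lt_one {N : ℕ} {s : ℂ} (hs : (N : ℝ) < s.re) :
    ‖(resCard R : ℂ) ^ N * (resCard R : ℂ) ^ (-s)‖ < 1 := by
  have hq : (1 : ℝ) < resCard R := by exact_mod_cast one_lt_resCard R
  have hq0 : (0 : ℝ) < resCard R := by linarith
  rw [norm_mul, norm_pow, Complex.norm_natCast, Complex.norm_natCast_cpow_of_pos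
    (by exact_mod_cast hq0), ← Real.rpow_natCast, ← Real.rpow_add hq0, Complex.neg_re]
  exact Real.rpow_lt_one_of_one_lt_of_neg hq (by linarith)

/-- Submodules of R^N × R are parametrized by their projection H, their intersection I with the last
factor, and a homomorphism H → R/I. As H is free of rank N there are |R/I|^N of these, so the sum
splits into the one for R^N and a geometric series over I = 𝔐^k. -/
theorem summable_and_hasSum_indexTerm (N : ℕ) {s : ℂ} (hs : (N : ℝ) - 1 < s.re) :
    (Summable fun H : FinIndexSubmodule R (Fin N → R) => ‖indexTerm s H.1‖) ∧
    HasSum (fun H : FinIndexSubmodule R (Fin N → R) => indexTerm s H.1)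
      (∏ i ∈ Finset.range N, (1 - (resCard R : ℂ) ^ i * (resCard R : ℂ) ^ (-s))⁻¹) := by
  induction N with
  | zero =>
    have hu : Unique (FinIndexSubmodule R (Fin 0 → R)) :=
      { default := ⟨⊤, inferInstance⟩
        uniq := fun H => Subtype.ext (Subsingleton.elim _ _) }
    refine ⟨Summable.of_finite, ?_⟩
    convert! hasSum_fintype _
    rw [Fintype.sum_unique]
    rw [indexTerm, Nat.card_unique]
    simp
  | succ N ih =>
    push_cast at hs
    obtain ⟨ih1, ih2⟩ := ih (by linarith)
    have hx := norm_resCard_pow_mul_lt_one R (N := N) (s := s) (by linarith)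
    set x := (resCard R : ℂ) ^ N * (resCard R : ℂ) ^ (-s) with hxdef
    -- The weight q^{kN} counts the homomorphisms into R/𝔐^k; times q^{-ks} it is the k-th power of
    -- q^{N-s}.
    have hterm : ∀ k : ℕ, ((Nat.card (R ⧸ IsLocalRing.maximalIdeal R ^ k) ^ N : ℕ) : ℂ) *
        indexTerm s (IsLocalRing.maximalIdeal R ^ k) = x ^ k := by
      intro k
      rw [indexTerm, card_quotient_maximalIdeal_pow, hxdef, mul_pow]
      push_cast
      rw [← pow_mul, ← pow_mul, mul_comm k N]
      congr 1
      rw [natCast_pow_cpow]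
    have e := LinearEquiv.ofFinrankEq (R := R) ((Fin N → R) × R) (Fin (N + 1) → R) (by simp)
    let B := Equiv.ofBijective _ (maximalIdeal_pow_bijective R)
    have hI1 : Summable fun I : FinIndexSubmodule R R =>
        ‖((Nat.card (R ⧸ I.1) ^ N : ℕ) : ℂ) * indexTerm s I.1‖ := by
      rw [← B.summable_iff]
      convert! (summable_geometric_of_norm_lt_one hx).norm using 2 with k
      exact congrArg _ (hterm k)
    have hI2 : HasSum (fun I : FinIndexSubmodule R R =>
        ((Nat.card (R ⧸ I.1) ^ N : ℕ) : ℂ) * indexTerm s I.1) (1 - x)⁻¹ := by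
      rw [← B.hasSum_iff]
      convert! hasSum_geometric_of_norm_lt_one hx using 2 with k
      exact hterm k
    have hsum : Summable fun y : FinIndexSubmodule R (Fin N → R) × FinIndexSubmodule R R =>
        indexTerm s y.1.1 * (((Nat.card (R ⧸ y.2.1) ^ N : ℕ) : ℂ) * indexTerm s y.2.1) := by
      apply summable_mul_of_summable_norm ih1 hI1
    have hmain := hasSum_of_fibers
      (fstInr : FinIndexSubmodule R ((Fin N → R) × R) → _)
      (fun K => indexTerm s K.1) (fun y => indexTerm s y.1.1 * indexTerm s y.2.1)
      (fun y => Nat.card (R ⧸ y.2.1) ^ N)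
      (fun y => ?_) (fun y => ?_) (fun K => ?_) (a := (∏ i ∈ Finset.range N,
        (1 - (resCard R : ℂ) ^ i * (resCard R : ℂ) ^ (-s))⁻¹) * (1 - x)⁻¹) ?_ ?_
    · rw [Finset.prod_range_succ, ← (finIndexSubmoduleCongr e).summable_iff,
        ← (finIndexSubmoduleCongr e).hasSum_iff]
      simpa only [Function.comp_def, indexTerm_finIndexSubmoduleCongr] using hmain
    · have := y.1.2
      have := y.2.2
      refine Nat.finite_of_card_ne_zero ?_
      rw [Nat.card_congr (fstInrFiberEquiv y), card_linearMap_of_finite_quotient]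
      exact pow_ne_zero _ ((finite_quotient_iff _).1 y.2.2)
    · have := y.1.2
      rw [Nat.card_congr (fstInrFiberEquiv y), card_linearMap_of_finite_quotient]
    · exact indexTerm_eq_mul s (card_quotient_prod K.1)
    · refine hsum.norm.congr fun y => ?_
      rw [norm_mul, norm_mul, norm_mul, Complex.norm_natCast]
      ring
    · have hprod := HasSum.mul ih2 hI2 hsum
      simp only [mul_left_comm (indexTerm s _)] at hprod
      exact hprod

theorem latticeZeta_ne_zero (N : ℕ) {s : ℂ} (hs : (N : ℝ) - 1 < s.re) :
    latticeZeta R (Fin N → R) s ≠ 0 := by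
  rw [latticeZeta, (summable_and_hasSum_indexTerm R N hs).2.tsum_eq]
  refine Finset.prod_ne_zero_iff.2 fun i hi => inv_ne_zero (sub_ne_zero.2 fun h => ?_)
  have hi' : (i : ℝ) + 1 ≤ N := by exact_mod_cast Finset.mem_range.1 hi
  have := norm_resCard_pow_mul_lt_one R (N := i) (s := s) (by linarith)
  rw [← h] at this
  simp at this

end Zeta

/-! ### Gaussian multinomials as products over positions -/

section Gauss

variable {K : Type*} [Field K]

theorem prod_Icc_one_eq_prod_range (f : ℕ → K) (n : ℕ) :
    ∏ i ∈ Finset.Icc 1 n, f i = ∏ i ∈ Finset.range n, f (i + 1) := by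
  rw [← Finset.Ico_add_one_right_eq_Icc, Finset.prod_Ico_eq_prod_range]
  simp [add_comm]

theorem gaussBinom_add_mul (m k : ℕ) {Y : K} (hY : ∀ i : ℕ, 1 - Y ^ (i + 1) ≠ 0) :
    gaussBinom (m + k) m Y * ((∏ i ∈ Finset.range m, (1 - Y ^ (i + 1))) *
      ∏ i ∈ Finset.range k, (1 - Y ^ (i + 1))) = ∏ i ∈ Finset.range (m + k), (1 - Y ^ (i + 1)) := by
  have h0 : ∏ i ∈ Finset.range m, (1 - Y ^ (i + 1)) ≠ 0 := Finset.prod_ne_zero_iff.2 fun i _ => hY i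
  have h1 : ∏ i ∈ Finset.Icc (k + 1) (m + k), (1 - Y ^ i) =
      ∏ i ∈ Finset.range m, (1 - Y ^ (k + i + 1)) := by
    rw [← Finset.Ico_add_one_right_eq_Icc, Finset.prod_Ico_eq_prod_range]
    have : m + k + 1 - (k + 1) = m := by omega
    rw [this]
    exact Finset.prod_congr rfl fun i _ => by ring
  rw [gaussBinom, Nat.add_sub_cancel_left, prod_Icc_one_eq_prod_range, h1, add_comm m k,
    Finset.prod_range_add]
  field_simp

theorem gaussMultinom_insert {N m : ℕ} {J : Finset ℕ} (h : ∀ x ∈ J, x < m) (Y : K) :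
    gaussMultinom N (insert m J) Y = gaussBinom N m Y * gaussMultinom m J Y := by
  have hm : m ∉ J := fun hm => lt_irrefl _ (h m hm)
  rw [gaussMultinom, Finset.sort_insert _ (fun b hb => (h b hb).le) hm]
  simp [gaussMultinom]

/-- The Gaussian multinomial is a quotient of products indexed by the positions; the denominator
measures the distance of each position to the preceding element of `J`. -/
theorem gaussMultinom_mul (J : Finset ℕ) {Y : K} (hY : ∀ i : ℕ, 1 - Y ^ (i + 1) ≠ 0) :
    ∀ N, (∀ j ∈ J, j < N) → gaussMultinom N J Y *
      ∏ i ∈ Finset.range N, (1 - Y ^ (i + 1 - (J.filter (· ≤ i)).sup id)) =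
      ∏ i ∈ Finset.range N, (1 - Y ^ (i + 1)) := by
  induction J using Finset.induction_on_max with
  | empty => simp [gaussMultinom]
  | insert m J hm ih =>
    intro N hN
    obtain ⟨k, rfl⟩ := Nat.exists_eq_add_of_le (hN m (Finset.mem_insert_self m J)).le
    rw [gaussMultinom_insert hm, ← gaussBinom_add_mul m k hY, ← ih m hm, Finset.prod_range_add]
    have h1 : ∏ i ∈ Finset.range m,
        (1 - Y ^ (i + 1 - ((insert m J).filter (· ≤ i)).sup id)) =
        ∏ i ∈ Finset.range m, (1 - Y ^ (i + 1 - (J.filter (· ≤ i)).sup id)) := by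
      refine Finset.prod_congr rfl fun i hi => ?_
      rw [Finset.filter_insert, if_neg (by simpa using hi)]
    have h2 : ∏ i ∈ Finset.range k,
        (1 - Y ^ (m + i + 1 - ((insert m J).filter (· ≤ m + i)).sup id)) =
        ∏ i ∈ Finset.range k, (1 - Y ^ (i + 1)) := by
      refine Finset.prod_congr rfl fun i hi => ?_
      have : ((insert m J).filter (· ≤ m + i)).sup id = m := by
        refine le_antisymm (Finset.sup_le fun x hx => ?_)
          (Finset.le_sup (f := id) (b := m) (by simp))
        rcases Finset.mem_insert.1 (Finset.mem_filter.1 hx).1 with rfl | hx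
        · exact le_rfl
        · exact (hm x hx).le
      rw [this]
      congr 2
      omega
    rw [h1, h2]
    ring

end Gauss

/-! ### Combinatorics of partitions and the two factors of β -/

section Partition

variable {N : ℕ} {ν : Fin N → ℕ}

/-- The number of parts of `ν` that are greater than `v`. -/
def numGt (ν : Fin N → ℕ) (v : ℕ) : ℕ := (Finset.univ.filter fun j => v < ν j).card

theorem lt_numGt_iff (hν : Antitone ν) (v : ℕ) (j : Fin N) : (j : ℕ) < numGt ν v ↔ v < ν j := by
  constructor
  · intro h
    by_contra hj
    have : (Finset.univ.filter fun j => v < ν j) ⊆ Finset.Iio j := fun i hi => by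
      simp only [Finset.mem_filter, Finset.mem_univ, true_and] at hi
      rw [Finset.mem_Iio]
      by_contra hij
      exact hj (hi.trans_le (hν (not_lt.1 hij)))
    have := Finset.card_le_card this
    rw [Fin.card_Iio] at this
    exact absurd h (not_lt.2 this)
  · intro h
    have : Finset.Iic j ⊆ (Finset.univ.filter fun j => v < ν j) := fun i hi => by
      simpa using h.trans_le (hν (Finset.mem_Iic.1 hi))
    have := Finset.card_le_card this
    rw [Fin.card_Iic] at this
    exact this

theorem numGt_le (hν : Antitone ν) (i : Fin N) : numGt ν (ν i) ≤ i := by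
  by_contra h
  exact lt_irrefl _ ((lt_numGt_iff hν _ _).1 (not_le.1 h))

theorem part_eq (ν : Fin N → ℕ) {d : ℕ} (h : d - 1 < N) : part ν d = ν ⟨d - 1, h⟩ := dif_pos h

/-- The last jump before a position marks the start of its block of equal parts, so it counts the
strictly larger parts. This matches the denominator in `gaussMultinom_mul` with the automorphism
count. -/
theorem sup_jumps_filter_le (hν : Antitone ν) (i : Fin N) :
    ((jumps ν).filter (· ≤ (i : ℕ))).sup id = numGt ν (ν i) := by
  have hi := i.2
  apply le_antisymm
  · refine Finset.sup_le fun d hd => ?_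
    simp only [jumps, Finset.mem_filter, Finset.mem_Ico] at hd
    obtain ⟨⟨⟨h1, h2⟩, h3⟩, h4⟩ := hd
    -- Part number d + 1 has index d in `Fin N`, and d ≤ i makes it at least ν i.
    rw [part_eq ν (by omega : d + 1 - 1 < N), part_eq ν (by omega : d - 1 < N)] at h3
    have : ν i < ν ⟨d - 1, by omega⟩ := lt_of_le_of_lt (hν (by simpa [Fin.le_def] using h4)) h3
    have := (lt_numGt_iff hν _ _).2 this
    simp only [id] at this ⊢
    omega
  · rcases Nat.eq_zero_or_pos (numGt ν (ν i)) with h0 | h0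
    · rw [h0]
      exact Nat.zero_le _
    · have hle := numGt_le hν i
      have key := lt_numGt_iff hν (ν i)
      generalize numGt ν (ν i) = c at *
      -- The count c is itself a jump: part c exceeds ν i, while part c + 1 does not.
      refine Finset.le_sup (f := id) (Finset.mem_filter.2 ⟨?_, hle⟩)
      rw [jumps, Finset.mem_filter, Finset.mem_Ico]
      refine ⟨⟨h0, by omega⟩, ?_⟩
      rw [part_eq ν (by omega : c + 1 - 1 < N), part_eq ν (by omega : c - 1 < N)]
      refine lt_of_le_of_lt (b := ν i) ?_ ?_
      · rw [← not_lt, ← key]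
        simp
      · rw [← key]
        simp only
        omega

theorem sum_mul_sub_eq (f : ℕ → ℤ) (N : ℕ) :
    ∑ d ∈ Finset.range N, ((d : ℤ) + 1) * (f d - f (d + 1)) =
      ∑ i ∈ Finset.range N, f i - N * f N := by
  induction N with
  | zero => simp
  | succ N ih =>
    rw [Finset.sum_range_succ, ih, Finset.sum_range_succ]
    push_cast
    ring

/-- Summation by parts; for a decreasing f, the value f (max i j) is min (f i) (f j), which is the
exponent in the order of the endomorphism ring of M_ν. -/
theorem sum_mul_mul_sub_eq (f : ℕ → ℤ) (N : ℕ) :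
    ∑ d ∈ Finset.range N, ((d : ℤ) + 1) * (N - (d + 1)) * (f d - f (d + 1)) =
      N * ∑ i ∈ Finset.range N, f i -
        ∑ i ∈ Finset.range N, ∑ j ∈ Finset.range N, f (max i j) := by
  induction N with
  | zero => simp
  | succ N ih =>
    -- The new term d = N has a zero factor; the old terms each grow by (d + 1)(f d - f (d + 1)).
    have h1 : ∑ d ∈ Finset.range (N + 1), ((d : ℤ) + 1) * (((N + 1 : ℕ) : ℤ) - (d + 1)) *
        (f d - f (d + 1)) = ∑ d ∈ Finset.range N, ((d : ℤ) + 1) * (N - (d + 1)) *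
        (f d - f (d + 1)) + ∑ d ∈ Finset.range N, ((d : ℤ) + 1) * (f d - f (d + 1)) := by
      rw [Finset.sum_range_succ, ← Finset.sum_add_distrib]
      push_cast
      rw [sub_self, mul_zero, zero_mul, add_zero]
      exact Finset.sum_congr rfl fun d _ => by ring
    have h2 : ∑ i ∈ Finset.range (N + 1), ∑ j ∈ Finset.range (N + 1), f (max i j) =
        ∑ i ∈ Finset.range N, ∑ j ∈ Finset.range N, f (max i j) + (2 * N + 1) * f N := by
      simp only [Finset.sum_range_succ, Finset.sum_add_distrib, max_self]
      have h3 : ∑ i ∈ Finset.range N, f (max i N) = N * f N := by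
        rw [Finset.sum_congr rfl fun i hi => by
          rw [max_eq_right (Finset.mem_range.1 hi).le]]
        simp
      have h4 : ∑ i ∈ Finset.range N, f (max N i) = N * f N := by
        simp only [max_comm N, h3]
      rw [h3, h4]
      ring
    rw [h1, ih, sum_mul_sub_eq, h2, Finset.sum_range_succ]
    push_cast
    ring

theorem sum_mul_part_sub (hν : Antitone ν) :
    ∑ d ∈ Finset.Ico 1 N, d * (N - d) * (part ν d - part ν (d + 1)) + ∑ i, ∑ j, min (ν i) (ν j) =
      N * ∑ i, ν i := by
  set f : ℕ → ℤ := fun d => part ν (d + 1) with hf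
  have hfν : ∀ i : Fin N, f i = ν i := fun i => by simp [hf, part_eq]
  have key := sum_mul_mul_sub_eq f N
  have e1 : ((∑ i, ν i : ℕ) : ℤ) = ∑ i ∈ Finset.range N, f i := by
    rw [Finset.sum_range, Nat.cast_sum]
    exact Finset.sum_congr rfl fun i _ => (hfν i).symm
  have e2 : ((∑ i, ∑ j, min (ν i) (ν j) : ℕ) : ℤ) =
      ∑ i ∈ Finset.range N, ∑ j ∈ Finset.range N, f (max i j) := by
    rw [Finset.sum_range, Nat.cast_sum]
    refine Finset.sum_congr rfl fun i _ => ?_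
    rw [Finset.sum_range, Nat.cast_sum]
    refine Finset.sum_congr rfl fun j _ => ?_
    have : ((i : ℕ) ⊔ (j : ℕ)) = ((max i j : Fin N) : ℕ) := by
      rcases le_total i j with h | h
      · rw [max_eq_right h, max_eq_right (Fin.le_def.1 h)]
      · rw [max_eq_left h, max_eq_left (Fin.le_def.1 h)]
    rw [this, hfν, hν.map_max]
  have e3 : ((∑ d ∈ Finset.Ico 1 N, d * (N - d) * (part ν d - part ν (d + 1)) : ℕ) : ℤ) =
      ∑ d ∈ Finset.range N, ((d : ℤ) + 1) * (N - (d + 1)) * (f d - f (d + 1)) := by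
    rcases Nat.eq_zero_or_pos N with rfl | hN
    · simp
    · obtain ⟨n, rfl⟩ := Nat.exists_eq_add_of_lt hN
      simp only [zero_add]
      rw [Finset.sum_range_succ, Finset.sum_Ico_eq_sum_range, Nat.add_sub_cancel, Nat.cast_sum]
      push_cast
      simp only [sub_self, mul_zero, zero_mul, add_zero]
      refine Finset.sum_congr rfl fun d hd => ?_
      have hd' := Finset.mem_range.1 hd
      have hle : part ν (1 + d + 1) ≤ part ν (1 + d) := by
        rw [part_eq ν (by omega : 1 + d + 1 - 1 < 0 + n + 1),
          part_eq ν (by omega : 1 + d - 1 < 0 + n + 1)]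
        exact hν (by simp [Fin.le_def])
      rw [Nat.cast_sub hle, Nat.cast_sub (by omega), hf]
      push_cast
      rw [add_comm 1 d]
      ring
  have : ((∑ d ∈ Finset.Ico 1 N, d * (N - d) * (part ν d - part ν (d + 1)) +
      ∑ i, ∑ j, min (ν i) (ν j) : ℕ) : ℤ) = ((N * ∑ i, ν i : ℕ) : ℤ) := by
    rw [Nat.cast_add, Nat.cast_mul, e1, e2, e3, key]
    ring
  exact_mod_cast this

/-- This writes β as the surjection count over the automorphism count, with denominators cleared.
Both sides carry one extra common factor, due to the zero parts. -/
theorem beta_mul {K : Type*} [Field K] (hν : Antitone ν) {Y : K}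
    (hY : ∀ i : ℕ, Y ^ (i + 1) ≠ 1) :
    beta ν Y * (Y ^ (∑ i, ∑ j, min (ν i) (ν j)) *
      ∏ i : Fin N, (1 - Y⁻¹ ^ ((i : ℕ) + 1 - numGt ν (ν i)))) =
      Y ^ (N * ∑ i, ν i) * ∏ i : Fin N, (1 - Y⁻¹ ^ ((i : ℕ) + 1)) := by
  have hY' : ∀ i : ℕ, 1 - Y⁻¹ ^ (i + 1) ≠ 0 := fun i h => hY i (by
    rw [inv_pow, sub_eq_zero, eq_comm, inv_eq_one] at h
    exact h)
  have h := gaussMultinom_mul (jumps ν) hY' N fun j hj => by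
    simp only [jumps, Finset.mem_filter, Finset.mem_Ico] at hj
    exact hj.1.2
  rw [Finset.prod_range, Finset.prod_range] at h
  simp only [sup_jumps_filter_le hν] at h
  rw [beta, ← sum_mul_part_sub hν, pow_add, ← h]
  ring

end Partition

/-! ### Counting over a finite field -/

section Counting

/-- All fibres of a surjective homomorphism are cosets of its kernel, so a property read off from
the image has the same proportion in source and target. -/
theorem card_subtype_comp_mul_card {G H : Type*} [AddCommGroup G] [AddCommGroup H]
    (f : G →+ H) (hf : Function.Surjective f) (P : H → Prop) :
    Nat.card {g // P (f g)} * Nat.card H = Nat.card G * Nat.card {h // P h} := by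
  have key : ∀ Q : H → Prop, Nat.card {g // Q (f g)} = Nat.card {h // Q h} * Nat.card f.ker := by
    intro Q
    rw [← Nat.card_prod]
    refine Nat.card_congr
      { toFun := fun g => (⟨f g.1, g.2⟩, ⟨g.1 - Function.surjInv hf (f g.1), ?_⟩)
        invFun := fun z => ⟨z.2.1 + Function.surjInv hf z.1.1, ?_⟩
        left_inv := ?_
        right_inv := ?_ }
    · rw [AddMonoidHom.mem_ker, map_sub, Function.surjInv_eq hf, sub_self]
    · rw [map_add, Function.surjInv_eq hf, AddMonoidHom.mem_ker.1 z.2.2, zero_add]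
      exact z.1.2
    · intro g
      simp
    · rintro ⟨⟨h, hh⟩, ⟨z, hz⟩⟩
      have h1 : f (z + Function.surjInv hf h) = h := by
        rw [map_add, Function.surjInv_eq hf, AddMonoidHom.mem_ker.1 hz, zero_add]
      ext
      · exact h1
      · simp [h1]
  have h1 := key fun _ => True
  rw [Nat.card_congr (Equiv.subtypeUnivEquiv fun _ => trivial),
    Nat.card_congr (Equiv.subtypeUnivEquiv fun _ => trivial)] at h1
  rw [key P, h1]
  ring

variable {k V : Type*} [Field k] [AddCommGroup V] [Module k V] [Finite V]

/-- The number of linearly independent families whose members are taken from the members of a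
decreasing chain of subspaces. -/
theorem card_linearIndependent_mem {m : ℕ} (W : Fin m → Submodule k V) (hW : Antitone W) :
    Nat.card {v : Fin m → V // LinearIndependent k v ∧ ∀ i, v i ∈ W i} =
      ∏ i, (Nat.card k ^ finrank k (W i) - Nat.card k ^ (m - 1 - (i : ℕ))) := by
  induction m with
  | zero =>
    rw [Finset.univ_eq_empty, Finset.prod_empty, Nat.card_eq_one_iff_unique]
    exact ⟨inferInstance, ⟨⟨Fin.elim0, linearIndependent_empty_type, fun i => i.elim0⟩⟩⟩
  | succ m ih =>
    let T := {v : Fin m → V // LinearIndependent k v ∧ ∀ i, v i ∈ W i.succ}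
    -- The vector with index 0 is chosen last: its subspace is the largest, so it contains the span
    -- of the others, and that span has q^m elements to be avoided.
    have e : {v : Fin (m + 1) → V // LinearIndependent k v ∧ ∀ i, v i ∈ W i} ≃
        Σ v : T, {x : V // x ∈ W 0 ∧ x ∉ Submodule.span k (Set.range v.1)} :=
      { toFun := fun v => ⟨⟨Fin.tail v.1, (linearIndependent_finSucc.1 v.2.1).1,
          fun i => v.2.2 i.succ⟩, ⟨v.1 0, v.2.2 0, (linearIndependent_finSucc.1 v.2.1).2⟩⟩
        invFun := fun z => ⟨Fin.cons z.2.1 z.1.1, linearIndependent_finCons.2 ⟨z.1.2.1, z.2.2.2⟩,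
          fun i => by
            refine Fin.cases ?_ (fun j => ?_) i
            · exact z.2.2.1
            · exact z.1.2.2 j⟩
        left_inv := fun v => Subtype.ext (Fin.cons_self_tail v.1)
        right_inv := fun z => rfl }
    have hc : ∀ v : T, Nat.card {x : V // x ∈ W 0 ∧ x ∉ Submodule.span k (Set.range v.1)} =
        Nat.card k ^ finrank k (W 0) - Nat.card k ^ m := by
      intro v
      have hle : (Submodule.span k (Set.range v.1) : Set V) ⊆ W 0 := by
        rw [SetLike.coe_subset_coe, Submodule.span_le]
        rintro _ ⟨i, rfl⟩
        exact hW (Fin.zero_le _) (v.2.2 i)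
      have h1 := Set.ncard_sdiff hle (Set.toFinite _)
      rw [← Nat.card_coe_set_eq, ← Nat.card_coe_set_eq, ← Nat.card_coe_set_eq] at h1
      have h2 := Module.natCard_eq_pow_finrank (K := k) (V := W 0)
      have h3 := Module.natCard_eq_pow_finrank (K := k) (V := Submodule.span k (Set.range v.1))
      rw [finrank_span_eq_card v.2.1, Fintype.card_fin] at h3
      rw [← h2, ← h3]
      exact h1
    have : Fintype T := Fintype.ofFinite T
    rw [Nat.card_congr e, Nat.card_sigma, Fin.prod_univ_succ]
    simp only [hc, Finset.sum_const, Finset.card_univ, smul_eq_mul]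
    rw [← Nat.card_eq_fintype_card, ih (fun i => W i.succ) fun i j hij =>
      hW (Fin.succ_le_succ_iff.2 hij), mul_comm]
    congr 1
    refine Finset.prod_congr rfl fun i _ => ?_
    rw [Fin.val_succ]
    congr 2
    omega

/-- Row rank equals column rank. -/
theorem span_range_eq_top_iff {r N : ℕ} (v : Fin N → Fin r → k) :
    Submodule.span k (Set.range v) = ⊤ ↔
      LinearIndependent k fun (a : Fin r) (j : Fin N) => v j a := by
  have h1 := Matrix.rank_eq_finrank_span_row (Matrix.of v)
  have h2 := Matrix.rank_eq_finrank_span_row (Matrix.of v).transpose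
  rw [Matrix.rank_transpose, h1] at h2
  rw [linearIndependent_iff_card_eq_finrank_span, Fintype.card_fin]
  change _ ↔ r = finrank k (Submodule.span k (Set.range (Matrix.of v).transpose.row))
  rw [← h2]
  constructor
  · intro h
    change r = finrank k (Submodule.span k (Set.range v))
    rw [h, finrank_top, finrank_fin_fun]
  · intro h
    refine Submodule.eq_top_of_finrank_eq ?_
    rw [finrank_fin_fun]
    exact h.symm

theorem card_span_range_eq_top [Finite k] {r N : ℕ} (hr : r ≤ N) :
    Nat.card {v : Fin N → Fin r → k // Submodule.span k (Set.range v) = ⊤} =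
      ∏ i : Fin r, (Nat.card k ^ N - Nat.card k ^ (i : ℕ)) := by
  have := Fintype.ofFinite k
  have h := card_linearIndependent (K := k) (V := Fin N → k) (k := r) (by simpa using hr)
  rw [finrank_fin_fun, ← Nat.card_eq_fintype_card] at h
  rw [← h]
  exact Nat.card_congr ((Equiv.piComm _).subtypeEquiv fun v => span_range_eq_top_iff v)

/-- The vectors whose coordinates at the indices in `P` vanish. -/
def coordSubspace (k : Type*) [Field k] {r : ℕ} (P : Fin r → Prop) : Submodule k (Fin r → k) :=
  LinearMap.ker (LinearMap.funLeft k k (Subtype.val : {b // P b} → Fin r))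

theorem mem_coordSubspace {r : ℕ} {P : Fin r → Prop} {v : Fin r → k} :
    v ∈ coordSubspace k P ↔ ∀ b, P b → v b = 0 := by
  rw [coordSubspace, LinearMap.mem_ker, funext_iff, Subtype.forall]
  rfl

theorem finrank_coordSubspace {r : ℕ} (P : Fin r → Prop) [DecidablePred P] :
    finrank k (coordSubspace k P) = r - (Finset.univ.filter P).card := by
  have h := LinearMap.finrank_range_add_finrank_ker
    (LinearMap.funLeft k k (Subtype.val : {b // P b} → Fin r))
  rw [LinearMap.range_eq_top.2 (LinearMap.funLeft_surjective_of_injective k k _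
    Subtype.val_injective), finrank_top, finrank_fintype_fun_eq_card, finrank_fin_fun,
    Fintype.card_subtype] at h
  exact Nat.eq_sub_of_add_eq ((add_comm _ _).trans h)

end Counting

/-! ### Torsion in R/𝔐^b -/

section Torsion

variable {R : Type*} [CommRing R] [IsDomain R] [IsDiscreteValuationRing R]

/-- Multiplication by ϖ^{b-a}, with truncated subtraction, maps R onto the torsion submodule with
kernel 𝔐^{min a b}. -/
theorem card_torsionBy_quotient {ϖ : R} (hϖ : Irreducible ϖ) (a b : ℕ) :
    Nat.card (Submodule.torsionBy R (R ⧸ IsLocalRing.maximalIdeal R ^ b) (ϖ ^ a)) =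
      resCard R ^ min a b := by
  have hmem : ∀ (c : ℕ) (x : R), x ∈ IsLocalRing.maximalIdeal R ^ c ↔ ϖ ^ c ∣ x := fun c x => by
    rw [hϖ.maximalIdeal_eq, Ideal.span_singleton_pow, Ideal.mem_span_singleton]
  let f : R →ₗ[R] R ⧸ IsLocalRing.maximalIdeal R ^ b :=
    (Submodule.mkQ _).comp (LinearMap.lsmul R R (ϖ ^ (b - a)))
  have hfx : ∀ x, f x = Ideal.Quotient.mk _ (ϖ ^ (b - a) * x) := fun x => rfl
  have h0 : ∀ c, ϖ ^ c ≠ 0 := fun c => pow_ne_zero _ hϖ.ne_zero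
  have hker : LinearMap.ker f = IsLocalRing.maximalIdeal R ^ min a b := by
    ext x
    rw [LinearMap.mem_ker, hfx, Ideal.Quotient.eq_zero_iff_mem, hmem, hmem]
    have : ϖ ^ b = ϖ ^ (b - a) * ϖ ^ min a b := by rw [← pow_add]; congr 1; omega
    rw [this, mul_dvd_mul_iff_left (h0 _)]
  have hrange : LinearMap.range f = Submodule.torsionBy R _ (ϖ ^ a) := by
    ext y
    obtain ⟨y, rfl⟩ := Ideal.Quotient.mk_surjective y
    rw [Submodule.mem_torsionBy_iff, LinearMap.mem_range]
    have hs : ϖ ^ a • (Ideal.Quotient.mk (IsLocalRing.maximalIdeal R ^ b) y) =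
      Ideal.Quotient.mk _ (ϖ ^ a * y) := rfl
    rw [hs, Ideal.Quotient.eq_zero_iff_mem, hmem]
    have hle : ϖ ^ (b - a) * ϖ ^ min a b = ϖ ^ b := by rw [← pow_add]; congr 1; omega
    constructor
    · rintro ⟨x, hx⟩
      rw [hfx, Ideal.Quotient.eq, hmem] at hx
      have h1 : ϖ ^ b ∣ ϖ ^ a * (ϖ ^ (b - a) * x) := by
        rw [← mul_assoc, ← pow_add]
        exact Dvd.dvd.mul_right (pow_dvd_pow _ (by omega)) _
      have h2 := Dvd.dvd.mul_left hx (ϖ ^ a)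
      rw [mul_sub] at h2
      exact (dvd_sub_right h1).1 h2
    · intro h
      rcases le_total b a with hab | hab
      · exact ⟨y, by rw [hfx, Nat.sub_eq_zero_of_le hab, pow_zero, one_mul]⟩
      · have : ϖ ^ b = ϖ ^ a * ϖ ^ (b - a) := by rw [← pow_add]; congr 1; omega
        rw [this, mul_dvd_mul_iff_left (h0 _)] at h
        obtain ⟨x, rfl⟩ := h
        exact ⟨x, rfl⟩
  rw [← card_quotient_maximalIdeal_pow, ← hker, ← hrange]
  exact Nat.card_congr f.quotKerEquivRange.toEquiv.symm

end Torsion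

/-- Homomorphisms from `R^N` correspond to `N`-tuples. -/
noncomputable def homEquiv (R : Type*) [CommRing R] (N : ℕ) (M : Type*) [AddCommGroup M]
    [Module R M] : ((Fin N → R) →ₗ[R] M) ≃ (Fin N → M) :=
  ((Pi.basisFun R (Fin N)).constr R (M' := M)).symm.toEquiv

theorem homEquiv_apply {R : Type*} [CommRing R] {N : ℕ} {M : Type*} [AddCommGroup M] [Module R M]
    (φ : (Fin N → R) →ₗ[R] M) (j : Fin N) : homEquiv R N M φ j = φ (Pi.single j 1) := by
  simp [homEquiv, Basis.constr]

theorem apply_eq_sum_single {R : Type*} [CommRing R] {N : ℕ} {M : Type*} [AddCommGroup M]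
    [Module R M] (φ : (Fin N → R) →ₗ[R] M) (y : Fin N → R) :
    φ y = ∑ j, y j • φ (Pi.single j 1) := by
  conv_lhs => rw [← Finset.univ_sum_single y, map_sum]
  refine Finset.sum_congr rfl fun j _ => ?_
  rw [← map_smul, ← Pi.single_smul, smul_eq_mul, mul_one]

/-! ### Surjections onto M_ν and reduction to the residue field -/

section ElemDiv

variable (R : Type*) [CommRing R] [IsLocalRing R] {N : ℕ} (ν : Fin N → ℕ)

/-- The module `R / 𝔐^{ν_1} × ⋯ × R / 𝔐^{ν_N}`. -/
abbrev ElemDivModule : Type _ := Π j, R ⧸ IsLocalRing.maximalIdeal R ^ ν j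

/-- The projection of `R^N` onto `R / 𝔐^{ν_1} × ⋯ × R / 𝔐^{ν_N}`. -/
def elemDivMk : (Fin N → R) →ₗ[R] ElemDivModule R ν :=
  LinearMap.pi fun j => (Submodule.mkQ _).comp (LinearMap.proj j)

variable {R ν}

theorem elemDivMk_surjective : Function.Surjective (elemDivMk R ν) := fun x => by
  choose y hy using fun j => Submodule.mkQ_surjective _ (x j)
  exact ⟨y, funext hy⟩

theorem elemDivMk_apply_eq_zero {y : Fin N → R} {j : Fin N} :
    elemDivMk R ν y j = 0 ↔ y j ∈ IsLocalRing.maximalIdeal R ^ ν j :=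
  Ideal.Quotient.eq_zero_iff_mem

theorem exists_elemDivMk (x : ElemDivModule R ν) : ∃ y, elemDivMk R ν y = x :=
  elemDivMk_surjective x

end ElemDiv

section Reduction

variable (R : Type*) [CommRing R] [IsLocalRing R] {r m : ℕ} {ν : Fin (r + m) → ℕ}
  (hpos : ∀ a : Fin r, 0 < ν (Fin.castAdd m a))

/-- Reduction of the first `r` components modulo the maximal ideal. -/
noncomputable def reduction : ElemDivModule R ν →ₗ[R] (Fin r → IsLocalRing.ResidueField R) :=
  LinearMap.pi fun a => (Submodule.liftQ _ (Algebra.linearMap R (IsLocalRing.ResidueField R))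
    (fun x hx => by
      rw [LinearMap.mem_ker, Algebra.linearMap_apply, IsLocalRing.ResidueField.algebraMap_eq,
        IsLocalRing.residue_eq_zero_iff]
      exact Ideal.pow_le_self (hpos a).ne' hx)).comp (LinearMap.proj (Fin.castAdd m a))

variable {R}

theorem reduction_elemDivMk (y : Fin (r + m) → R) (a : Fin r) :
    reduction R hpos (elemDivMk R ν y) a = IsLocalRing.residue R (y (Fin.castAdd m a)) := rfl

theorem ker_reduction_le (hzero : ∀ b : Fin m, ν (Fin.natAdd r b) = 0) :
    LinearMap.ker (reduction R hpos) ≤ IsLocalRing.maximalIdeal R • ⊤ := by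
  intro x hx
  obtain ⟨y, rfl⟩ := exists_elemDivMk x
  rw [pi_eq_sum_univ y, map_sum]
  refine Submodule.sum_mem _ fun j _ => ?_
  rw [map_smul]
  refine Fin.addCases (fun a => ?_) (fun b => ?_) j
  · refine Submodule.smul_mem_smul ?_ Submodule.mem_top
    rw [← IsLocalRing.residue_eq_zero_iff, ← reduction_elemDivMk hpos, LinearMap.mem_ker.1 hx,
      Pi.zero_apply]
  · convert! Submodule.zero_mem _
    ext i
    rw [← map_smul, Pi.zero_apply, elemDivMk_apply_eq_zero, Pi.smul_apply]
    by_cases h : Fin.natAdd r b = i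
    · subst h
      rw [hzero, pow_zero, Ideal.one_eq_top]
      exact Submodule.mem_top
    · rw [if_neg h, smul_zero]
      exact Submodule.zero_mem _

/-- Nakayama's lemma: the kernel of the reduction is contained in 𝔐 M_ν, since the components with
ν_j = 0 vanish. -/
theorem surjective_iff_span_reduction (hzero : ∀ b : Fin m, ν (Fin.natAdd r b) = 0) {N : ℕ}
    (φ : (Fin N → R) →ₗ[R] ElemDivModule R ν) :
    Function.Surjective φ ↔ Submodule.span (IsLocalRing.ResidueField R)
      (Set.range fun j => reduction R hpos (φ (Pi.single j 1))) = ⊤ := by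
  have hφ : ∀ y, φ y = ∑ j, y j • φ (Pi.single j 1) := apply_eq_sum_single φ
  have hred : ∀ y, reduction R hpos (φ y) =
      ∑ j, IsLocalRing.residue R (y j) • reduction R hpos (φ (Pi.single j 1)) := fun y => by
    rw [hφ, map_sum]
    refine Finset.sum_congr rfl fun j _ => ?_
    rw [map_smul, ← IsLocalRing.ResidueField.algebraMap_eq, algebraMap_smul]
  constructor
  · intro hs
    rw [eq_top_iff]
    intro v _
    choose c hc using fun a => IsLocalRing.residue_surjective (v a)
    obtain ⟨y, hy⟩ := hs (elemDivMk R ν (Fin.append c 0))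
    have : v = reduction R hpos (φ y) := by
      ext a
      rw [hy, reduction_elemDivMk, Fin.append_left, hc]
    rw [this, hred]
    exact Submodule.sum_mem _ fun j _ =>
      Submodule.smul_mem _ _ (Submodule.subset_span ⟨j, rfl⟩)
  · intro hs
    rw [← LinearMap.range_eq_top, eq_top_iff]
    refine Submodule.le_of_le_smul_of_le_jacobson_bot (I := IsLocalRing.maximalIdeal R)
      Module.Finite.fg_top (IsLocalRing.maximalIdeal_le_jacobson _) ?_
    intro x _
    have hx : reduction R hpos x ∈ Submodule.span (IsLocalRing.ResidueField R)
      (Set.range fun j => reduction R hpos (φ (Pi.single j 1))) := hs ▸ Submodule.mem_top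
    obtain ⟨c, hc⟩ := (Submodule.mem_span_range_iff_exists_fun _).1 hx
    choose y hy using fun j => IsLocalRing.residue_surjective (c j)
    have : x = φ y + (x - φ y) := by abel
    rw [this]
    refine Submodule.add_mem_sup (LinearMap.mem_range_self φ y) (ker_reduction_le hpos hzero ?_)
    rw [LinearMap.mem_ker, map_sub, hred, sub_eq_zero, ← hc]
    simp only [hy]

end Reduction

section Kernels

variable {R : Type*} [CommRing R] [IsLocalRing R] {N : ℕ} {ν : Fin N → ℕ}

/-- The surjections onto a module with a given kernel correspond to isomorphisms from the
quotient. -/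
noncomputable def surjectiveKerEquiv {M Q : Type*} [AddCommGroup M] [Module R M] [AddCommGroup Q]
    [Module R Q] (H : Submodule R M) :
    {φ : M →ₗ[R] Q // Function.Surjective φ ∧ LinearMap.ker φ = H} ≃ ((M ⧸ H) ≃ₗ[R] Q) where
  toFun φ := (Submodule.quotEquivOfEq _ _ φ.2.2.symm).trans
    (φ.1.quotKerEquivOfSurjective φ.2.1)
  invFun e := ⟨e.toLinearMap.comp H.mkQ, e.surjective.comp H.mkQ_surjective, by
    rw [LinearMap.ker_comp, LinearEquiv.ker, ← LinearMap.ker, Submodule.ker_mkQ]⟩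
  left_inv φ := by
    ext x
    rfl
  right_inv e := by
    ext x
    obtain ⟨x, rfl⟩ := H.mkQ_surjective x
    rfl

/-- The surjections with a given kernel H correspond to the isomorphisms from R^N/H to M_ν, which
form a torsor under Aut M_ν. -/
theorem card_surjective_eq_mul (hν : Antitone ν) :
    Nat.card {φ : (Fin N → R) →ₗ[R] ElemDivModule R ν // Function.Surjective φ} =
      Nat.card {H : Submodule R (Fin N → R) // IsElemDivType H ν} *
        Nat.card (ElemDivModule R ν ≃ₗ[R] ElemDivModule R ν) := by
  let S := {φ : (Fin N → R) →ₗ[R] ElemDivModule R ν // Function.Surjective φ}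
  let T := {H : Submodule R (Fin N → R) // IsElemDivType H ν}
  let p : S → T := fun φ => ⟨LinearMap.ker φ.1, hν, ⟨φ.1.quotKerEquivOfSurjective φ.2⟩⟩
  have hfib : ∀ H : T, Nonempty ({φ : S // p φ = H} ≃
      (ElemDivModule R ν ≃ₗ[R] ElemDivModule R ν)) := by
    intro H
    obtain ⟨e⟩ := H.2.2
    have e1 : {φ : S // p φ = H} ≃ {φ : (Fin N → R) →ₗ[R] ElemDivModule R ν //
        Function.Surjective φ ∧ LinearMap.ker φ = H.1} :=
      { toFun := fun φ => ⟨φ.1.1, φ.1.2, congrArg Subtype.val φ.2⟩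
        invFun := fun φ => ⟨⟨φ.1, φ.2.1⟩, Subtype.ext φ.2.2⟩
        left_inv := fun _ => rfl
        right_inv := fun _ => rfl }
    exact ⟨(e1.trans (surjectiveKerEquiv H.1)).trans
      { toFun := fun f => e.symm.trans f
        invFun := fun f => e.trans f
        left_inv := fun f => by ext; simp
        right_inv := fun f => by ext; simp }⟩
  have e2 : S ≃ T × (ElemDivModule R ν ≃ₗ[R] ElemDivModule R ν) :=
    (Equiv.sigmaFiberEquiv p).symm.trans ((Equiv.sigmaCongrRight fun H => (hfib H).some).trans
      (Equiv.sigmaEquivProd _ _))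
  rw [← Nat.card_prod]
  exact Nat.card_congr e2

end Kernels

/-! ### Automorphisms of M_ν -/

section Automorphisms

variable {R : Type*} [CommRing R] [IsDomain R] [IsDiscreteValuationRing R]
  {N : ℕ} {ν : Fin N → ℕ}

/-- Automorphisms of `R / 𝔐^{ν_1} × ⋯ × R / 𝔐^{ν_N}` correspond to the surjections of `R^N`
which map the `j`-th basis vector to an element annihilated by `ϖ^{ν_j}`. -/
theorem card_automorphisms {ϖ : R} (hϖ : Irreducible ϖ) :
    Nat.card (ElemDivModule R ν ≃ₗ[R] ElemDivModule R ν) =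
      Nat.card {φ : (Fin N → R) →ₗ[R] ElemDivModule R ν // Function.Surjective φ ∧
        ∀ j, φ (Pi.single j 1) ∈ Submodule.torsionBy R (ElemDivModule R ν) (ϖ ^ ν j)} := by
  have hann : ∀ j, ϖ ^ ν j • elemDivMk R ν (Pi.single j 1) = 0 := by
    intro j
    rw [← map_smul]
    ext i
    rw [Pi.zero_apply, elemDivMk_apply_eq_zero, Pi.smul_apply]
    by_cases h : i = j
    · subst h
      rw [Pi.single_eq_same, smul_eq_mul, mul_one, hϖ.maximalIdeal_eq]
      exact Ideal.pow_mem_pow (Ideal.mem_span_singleton_self ϖ) _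
    · rw [Pi.single_eq_of_ne h, smul_zero]
      exact Submodule.zero_mem _
  refine Nat.card_congr (Equiv.ofBijective (fun e => ⟨e.toLinearMap.comp (elemDivMk R ν),
    e.surjective.comp elemDivMk_surjective, fun j => ?_⟩) ⟨?_, ?_⟩)
  · rw [Submodule.mem_torsionBy_iff, LinearMap.comp_apply, ← map_smul, hann, map_zero]
  · intro e f h
    have h' : e.toLinearMap.comp (elemDivMk R ν) = f.toLinearMap.comp (elemDivMk R ν) :=
      congrArg Subtype.val h
    ext x : 1
    obtain ⟨y, rfl⟩ := exists_elemDivMk x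
    exact LinearMap.congr_fun h' y
  · rintro ⟨φ, hφ, htor⟩
    have hker : LinearMap.ker (elemDivMk R ν) ≤ LinearMap.ker φ := by
      intro y hy
      rw [LinearMap.mem_ker, apply_eq_sum_single φ y]
      refine Finset.sum_eq_zero fun j _ => ?_
      have hj : y j ∈ IsLocalRing.maximalIdeal R ^ ν j := by
        rw [← elemDivMk_apply_eq_zero, LinearMap.mem_ker.1 hy, Pi.zero_apply]
      rw [hϖ.maximalIdeal_eq, Ideal.span_singleton_pow, Ideal.mem_span_singleton'] at hj
      obtain ⟨c, hc⟩ := hj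
      rw [← hc, mul_smul, (Submodule.mem_torsionBy_iff _ _).1 (htor j), smul_zero]
    let g : ElemDivModule R ν →ₗ[R] ElemDivModule R ν :=
      ((LinearMap.ker (elemDivMk R ν)).liftQ φ hker).comp
        ((elemDivMk R ν).quotKerEquivOfSurjective elemDivMk_surjective).symm.toLinearMap
    have hg : ∀ y, g (elemDivMk R ν y) = φ y := by
      intro y
      have : ((elemDivMk R ν).quotKerEquivOfSurjective elemDivMk_surjective).symm
          (elemDivMk R ν y) = Submodule.Quotient.mk y := by
        rw [LinearEquiv.symm_apply_eq]
        rfl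
      change (LinearMap.ker (elemDivMk R ν)).liftQ φ hker _ = _
      rw [LinearEquiv.coe_coe, this]
      rfl
    have hgs : Function.Surjective g := fun x => by
      obtain ⟨y, rfl⟩ := hφ x
      exact ⟨_, hg y⟩
    -- A surjective endomorphism of a finitely generated module is injective.
    have hgi := OrzechProperty.injective_of_surjective_endomorphism g hgs
    refine ⟨LinearEquiv.ofBijective g ⟨hgi, hgs⟩, Subtype.ext (LinearMap.ext hg)⟩

theorem card_elemDivModule : Nat.card (ElemDivModule R ν) = resCard R ^ ∑ j, ν j := by
  rw [Nat.card_pi, ← Finset.prod_pow_eq_pow_sum]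
  exact Finset.prod_congr rfl fun j _ => card_quotient_maximalIdeal_pow R (ν j)

theorem card_torsionBy_elemDivModule {ϖ : R} (hϖ : Irreducible ϖ) (a : ℕ) :
    Nat.card (Submodule.torsionBy R (ElemDivModule R ν) (ϖ ^ a)) =
      resCard R ^ ∑ j, min a (ν j) := by
  have e : Submodule.torsionBy R (ElemDivModule R ν) (ϖ ^ a) ≃
      Π j, Submodule.torsionBy R (R ⧸ IsLocalRing.maximalIdeal R ^ ν j) (ϖ ^ a) :=
    { toFun := fun x j => ⟨x.1 j, congrFun x.2 j⟩
      invFun := fun x => ⟨fun j => (x j).1, funext fun j => (x j).2⟩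
      left_inv := fun _ => rfl
      right_inv := fun _ => rfl }
  rw [Nat.card_congr e, Nat.card_pi, ← Finset.prod_pow_eq_pow_sum]
  exact Finset.prod_congr rfl fun j _ => card_torsionBy_quotient hϖ a (ν j)

instance [Finite (IsLocalRing.ResidueField R)] : Finite (ElemDivModule R ν) :=
  Nat.finite_of_card_ne_zero (by
  rw [card_elemDivModule]
  exact pow_ne_zero _ (one_lt_resCard R).ne_bot)

end Automorphisms

/-! ### The number of submodules of given type is β -/

section TypeCount

variable {R : Type*} [CommRing R] [IsDomain R] [IsDiscreteValuationRing R]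
  {r m : ℕ} {ν : Fin (r + m) → ℕ}

/-- If ϖ^{ν_a} kills a class modulo 𝔐^{ν_b} with ν_b > ν_a, then ϖ divides its representatives. With
the converse below, this identifies the reduction of the torsion with a coordinate subspace. -/
theorem reduction_mem_coordSubspace {ϖ : R} (hϖ : Irreducible ϖ)
    (hpos : ∀ a : Fin r, 0 < ν (Fin.castAdd m a)) (a : Fin r) {x : ElemDivModule R ν}
    (hx : x ∈ Submodule.torsionBy R (ElemDivModule R ν) (ϖ ^ ν (Fin.castAdd m a))) :
    reduction R hpos x ∈ coordSubspace (IsLocalRing.ResidueField R)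
      (fun b => ν (Fin.castAdd m a) < ν (Fin.castAdd m b)) := by
  rw [mem_coordSubspace]
  intro b hb
  obtain ⟨y, rfl⟩ := exists_elemDivMk x
  rw [reduction_elemDivMk, IsLocalRing.residue_eq_zero_iff]
  rw [Submodule.mem_torsionBy_iff, ← map_smul] at hx
  have h1 := congrFun hx (Fin.castAdd m b)
  rw [Pi.zero_apply, elemDivMk_apply_eq_zero, Pi.smul_apply, hϖ.maximalIdeal_eq,
    Ideal.span_singleton_pow, Ideal.mem_span_singleton, smul_eq_mul] at h1
  rw [hϖ.maximalIdeal_eq, Ideal.mem_span_singleton]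
  have h2 : ϖ ^ ν (Fin.castAdd m a) * ϖ ∣ ϖ ^ ν (Fin.castAdd m a) * y (Fin.castAdd m b) :=
    (pow_succ ϖ (ν (Fin.castAdd m a)) ▸ pow_dvd_pow ϖ hb).trans h1
  exact (mul_dvd_mul_iff_left (pow_ne_zero _ hϖ.ne_zero)).1 h2

theorem exists_torsionBy_reduction_eq {ϖ : R} (hϖ : Irreducible ϖ)
    (hpos : ∀ a : Fin r, 0 < ν (Fin.castAdd m a)) (a : Fin r)
    {v : Fin r → IsLocalRing.ResidueField R}
    (hv : v ∈ coordSubspace (IsLocalRing.ResidueField R)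
      (fun b => ν (Fin.castAdd m a) < ν (Fin.castAdd m b))) :
    ∃ x ∈ Submodule.torsionBy R (ElemDivModule R ν) (ϖ ^ ν (Fin.castAdd m a)),
      reduction R hpos x = v := by
  classical
  rw [mem_coordSubspace] at hv
  choose c hc using fun b => IsLocalRing.residue_surjective (v b)
  let c' : Fin r → R := fun b => if ν (Fin.castAdd m a) < ν (Fin.castAdd m b) then 0 else c b
  refine ⟨elemDivMk R ν (Fin.append c' 0), ?_, ?_⟩
  · rw [Submodule.mem_torsionBy_iff, ← map_smul]
    ext j
    rw [Pi.zero_apply, elemDivMk_apply_eq_zero, Pi.smul_apply]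
    refine Fin.addCases (fun b => ?_) (fun b => ?_) j
    · rw [Fin.append_left]
      by_cases h : ν (Fin.castAdd m a) < ν (Fin.castAdd m b)
      · simp [c', h]
      · rw [smul_eq_mul, hϖ.maximalIdeal_eq]
        exact Ideal.mul_mem_right _ _ (Ideal.pow_le_pow_right (not_lt.1 h)
          (Ideal.pow_mem_pow (Ideal.mem_span_singleton_self ϖ) _))
    · simp
  · ext b
    rw [reduction_elemDivMk, Fin.append_left]
    by_cases h : ν (Fin.castAdd m a) < ν (Fin.castAdd m b)
    · simp [c', h, hv b h]
    · simp [c', h, hc]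

variable [Finite (IsLocalRing.ResidueField R)]

theorem card_surjective_mul (hpos : ∀ a : Fin r, 0 < ν (Fin.castAdd m a))
    (hzero : ∀ b : Fin m, ν (Fin.natAdd r b) = 0) :
    Nat.card {φ : (Fin (r + m) → R) →ₗ[R] ElemDivModule R ν // Function.Surjective φ} *
      resCard R ^ (r * (r + m)) =
      resCard R ^ ((r + m) * ∑ j, ν j) *
        ∏ i : Fin r, (resCard R ^ (r + m) - resCard R ^ (i : ℕ)) := by
  have hs : Function.Surjective (reduction R hpos) := fun v => by
    choose c hc using fun a => IsLocalRing.residue_surjective (v a)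
    refine ⟨elemDivMk R ν (Fin.append c 0), ?_⟩
    ext a
    rw [reduction_elemDivMk, Fin.append_left, hc]
  have h := card_subtype_comp_mul_card
    ((reduction R hpos).compLeft (Fin (r + m))).toAddMonoidHom
    (fun v => ⟨fun j => (hs (v j)).choose, funext fun j => (hs (v j)).choose_spec⟩)
    (fun v => Submodule.span (IsLocalRing.ResidueField R) (Set.range v) = ⊤)
  rw [card_span_range_eq_top (Nat.le_add_right r m), Nat.card_fun, Nat.card_fun, Nat.card_fun,
    Nat.card_fin, Nat.card_fin, card_elemDivModule, ← pow_mul, ← pow_mul,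
    mul_comm (∑ j, ν j)] at h
  rw [Nat.card_congr ((homEquiv R (r + m) (ElemDivModule R ν)).subtypeEquiv fun φ => ?_)]
  · exact h
  · rw [surjective_iff_span_reduction hpos hzero]
    simp only [← homEquiv_apply]
    rfl

/-- Automorphisms are tuples of torsion elements generating M_ν. Reduction maps the product of
torsion modules onto the product of the subspaces W a, which decrease with a, and generation becomes
linear independence of the first r reductions. -/
theorem card_automorphisms_mul (hν : Antitone ν) (hpos : ∀ a : Fin r, 0 < ν (Fin.castAdd m a))
    (hzero : ∀ b : Fin m, ν (Fin.natAdd r b) = 0) :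
    Nat.card (ElemDivModule R ν ≃ₗ[R] ElemDivModule R ν) *
      ∏ a : Fin r, resCard R ^ (r - numGt ν (ν (Fin.castAdd m a))) =
      resCard R ^ (∑ i, ∑ j, min (ν i) (ν j)) *
        ∏ a : Fin r, (resCard R ^ (r - numGt ν (ν (Fin.castAdd m a))) -
          resCard R ^ (r - 1 - (a : ℕ))) := by
  classical
  obtain ⟨ϖ, hϖ⟩ := IsDiscreteValuationRing.exists_irreducible R
  let k := IsLocalRing.ResidueField R
  let A : Fin (r + m) → Submodule R (ElemDivModule R ν) :=
    fun j => Submodule.torsionBy R (ElemDivModule R ν) (ϖ ^ ν j)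
  let W : Fin r → Submodule k (Fin r → k) :=
    fun a => coordSubspace k (fun b => ν (Fin.castAdd m a) < ν (Fin.castAdd m b))
  have hW : Antitone W := by
    intro a b hab v hv
    simp only [W, mem_coordSubspace] at hv ⊢
    have h : ν (Fin.castAdd m b) ≤ ν (Fin.castAdd m a) := hν (Fin.le_def.2 (Fin.le_def.1 hab))
    exact fun c hc => hv c (h.trans_lt hc)
  have hdim : ∀ a, finrank k (W a) = r - numGt ν (ν (Fin.castAdd m a)) := by
    intro a
    rw [finrank_coordSubspace, numGt]
    congr 1
    rw [← Finset.card_map (Fin.castAddEmb m)]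
    congr 1
    ext j
    simp only [Finset.mem_map, Finset.mem_filter, Finset.mem_univ, true_and]
    refine Fin.addCases (fun b => ?_) (fun b => ?_) j
    · simp
    · rw [hzero]
      simp only [not_lt_zero, iff_false, not_exists, not_and]
      intro c _ h
      exact absurd (congrArg Fin.val h) (by simp; omega)
  have hcW : ∀ a, Nat.card (W a) = resCard R ^ (r - numGt ν (ν (Fin.castAdd m a))) := by
    intro a
    rw [← hdim]
    exact Module.natCard_eq_pow_finrank
  let f : (Π j, A j) →+ (Π a, W a) :=
    { toFun := fun x a => ⟨reduction R hpos (x (Fin.castAdd m a)).1,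
        reduction_mem_coordSubspace hϖ hpos a (x (Fin.castAdd m a)).2⟩
      map_zero' := by
        ext a b
        simp
      map_add' := fun x y => by
        ext a b
        simp }
  have hf : Function.Surjective f := by
    intro v
    choose x hx hxv using fun a => exists_torsionBy_reduction_eq hϖ hpos a (v a).2
    refine ⟨fun j => Fin.addCases (motive := fun j => A j) (fun a => ⟨x a, hx a⟩) (fun _ => 0) j,
      funext fun a => Subtype.ext ?_⟩
    change reduction R hpos (Fin.addCases (motive := fun j => A j) _ _ (Fin.castAdd m a)).1 = _
    rw [Fin.addCases_left]
    exact hxv a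
  have h := card_subtype_comp_mul_card f hf fun v => LinearIndependent k fun a => (v a).1
  have hT : Nat.card {v : Π a, W a // LinearIndependent k fun a => (v a).1} =
      Nat.card {v : Fin r → Fin r → k // LinearIndependent k v ∧ ∀ a, v a ∈ W a} :=
    Nat.card_congr
      { toFun := fun v => ⟨fun a => (v.1 a).1, v.2, fun a => (v.1 a).2⟩
        invFun := fun v => ⟨fun a => ⟨v.1 a, v.2.2 a⟩, v.2.1⟩
        left_inv := fun _ => rfl
        right_inv := fun _ => rfl }
  have hA : Nat.card {x : Π j, A j // LinearIndependent k fun a => (f x a).1} =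
      Nat.card {φ : (Fin (r + m) → R) →ₗ[R] ElemDivModule R ν // Function.Surjective φ ∧
        ∀ j, φ (Pi.single j 1) ∈ Submodule.torsionBy R (ElemDivModule R ν) (ϖ ^ ν j)} := by
    have e : {x : Π j, A j // LinearIndependent k fun a => (f x a).1} ≃
        {x : Fin (r + m) → ElemDivModule R ν //
          (LinearIndependent k fun a : Fin r => reduction R hpos (x (Fin.castAdd m a))) ∧
          ∀ j, x j ∈ A j} :=
      { toFun := fun x => ⟨fun j => (x.1 j).1, x.2, fun j => (x.1 j).2⟩
        invFun := fun x => ⟨fun j => ⟨x.1 j, x.2.2 j⟩, x.2.1⟩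
        left_inv := fun _ => rfl
        right_inv := fun _ => rfl }
    rw [Nat.card_congr e]
    refine Nat.card_congr (Equiv.symm ?_)
    refine (homEquiv R (r + m) (ElemDivModule R ν)).subtypeEquiv fun φ => ?_
    rw [surjective_iff_span_reduction hpos hzero]
    simp only [homEquiv_apply]
    refine and_congr_left fun htor => ?_
    -- The basis vectors with ν_j = 0 go to elements annihilated by ϖ^0 = 1, that is, to 0.
    have hspan : Submodule.span k (Set.range fun j => reduction R hpos (φ (Pi.single j 1))) =
        Submodule.span k (Set.range fun a : Fin r =>
          reduction R hpos (φ (Pi.single (Fin.castAdd m a) 1))) := by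
      apply le_antisymm
      · rw [Submodule.span_le]
        rintro _ ⟨j, rfl⟩
        refine Fin.addCases (fun a => ?_) (fun b => ?_) j
        · exact Submodule.subset_span ⟨a, rfl⟩
        · have := htor (Fin.natAdd r b)
          rw [hzero, pow_zero, Submodule.mem_torsionBy_iff, one_smul] at this
          simp only [this, map_zero]
          exact Submodule.zero_mem _
      · refine Submodule.span_mono ?_
        rintro _ ⟨a, rfl⟩
        exact ⟨Fin.castAdd m a, rfl⟩
    rw [hspan, linearIndependent_iff_card_eq_finrank_span, Fintype.card_fin]
    constructor
    · intro h
      rw [Set.finrank, h, finrank_top, finrank_fin_fun]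
    · intro h
      refine Submodule.eq_top_of_finrank_eq ?_
      rw [finrank_fin_fun]
      exact h.symm
  rw [hT, hA, ← card_automorphisms hϖ, card_linearIndependent_mem W hW, Nat.card_pi,
    Nat.card_pi] at h
  simp only [hcW, hdim] at h
  rw [h, ← Finset.prod_pow_eq_pow_sum]
  congr 1
  exact Finset.prod_congr rfl fun j _ => card_torsionBy_elemDivModule hϖ (ν j)

theorem card_isElemDivType_of_zero_parts (hν : Antitone ν)
    (hpos : ∀ a : Fin r, 0 < ν (Fin.castAdd m a)) (hzero : ∀ b : Fin m, ν (Fin.natAdd r b) = 0) :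
    (Nat.card {H : Submodule R (Fin (r + m) → R) // IsElemDivType H ν} : ℂ) =
      beta ν (resCard R : ℂ) := by
  have hq1 := one_lt_resCard R
  have hq0 : (resCard R : ℂ) ≠ 0 := by exact_mod_cast hq1.ne_bot
  have hq : ∀ i : ℕ, (resCard R : ℂ) ^ (i + 1) ≠ 1 := fun i => by
    exact_mod_cast (Nat.one_lt_pow i.succ_ne_zero hq1).ne'
  have hY : ∀ i : ℕ, 0 < i → 1 - (resCard R : ℂ)⁻¹ ^ i ≠ 0 := fun i hi h => by
    obtain ⟨i, rfl⟩ := Nat.exists_eq_succ_of_ne_zero hi.ne'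
    rw [inv_pow, sub_eq_zero, eq_comm, inv_eq_one] at h
    exact hq i h
  have hsub : ∀ c d : ℕ, d ≤ c → ((resCard R ^ c - resCard R ^ d : ℕ) : ℂ) =
      (resCard R : ℂ) ^ c * (1 - (resCard R : ℂ)⁻¹ ^ (c - d)) := fun c d hdc => by
    rw [Nat.cast_sub (Nat.pow_le_pow_right (by omega) hdc), mul_sub, mul_one]
    push_cast
    congr 1
    rw [inv_pow, eq_mul_inv_iff_mul_eq₀ (pow_ne_zero _ hq0), ← pow_add]
    congr 1
    omega
  have hgt : ∀ a : Fin r, numGt ν (ν (Fin.castAdd m a)) ≤ a := fun a => numGt_le hν _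
  have hsur := congrArg (Nat.cast (R := ℂ)) (card_surjective_mul (R := R) hpos hzero)
  have haut := congrArg (Nat.cast (R := ℂ)) (card_automorphisms_mul (R := R) hν hpos hzero)
  have hmul := congrArg (Nat.cast (R := ℂ)) (card_surjective_eq_mul (R := R) hν)
  have hbeta := beta_mul hν hq
  rw [Fin.prod_univ_add] at hbeta
  set q : ℂ := (resCard R : ℂ) with hqdef
  -- Exactly r parts exceed a zero part; the resulting product over the m zero parts is the common
  -- factor that cancels against the one split off in `e2`.
  have e1 : ∏ b : Fin m, (1 - q⁻¹ ^ ((Fin.natAdd r b : ℕ) + 1 - numGt ν (ν (Fin.natAdd r b)))) =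
      ∏ b : Fin m, (1 - q⁻¹ ^ ((b : ℕ) + 1)) := by
    refine Finset.prod_congr rfl fun b _ => ?_
    have hn : numGt ν (ν (Fin.natAdd r b)) = r := by
      rw [hzero, numGt]
      conv_rhs => rw [← Fintype.card_fin r, ← Finset.card_univ,
        ← Finset.card_map (Fin.castAddEmb m)]
      congr 1
      ext j
      simp only [Finset.mem_map, Finset.mem_filter, Finset.mem_univ, true_and]
      refine Fin.addCases (fun a => ?_) (fun c => ?_) j
      · simp [hpos]
      · rw [hzero]
        simp only [lt_irrefl, false_iff, not_exists]
        intro c' h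
        exact absurd (congrArg Fin.val h) (by simp; omega)
    rw [hn, Fin.val_natAdd]
    congr 2
    omega
  have e2 : ∏ i : Fin (r + m), (1 - q⁻¹ ^ ((i : ℕ) + 1)) =
      (∏ b : Fin m, (1 - q⁻¹ ^ ((b : ℕ) + 1))) *
        ∏ i : Fin r, (1 - q⁻¹ ^ (r + m - (i : ℕ))) := by
    rw [← Finset.prod_range (fun i => 1 - q⁻¹ ^ (i + 1)),
      ← Finset.prod_range (fun i => 1 - q⁻¹ ^ (i + 1)),
      ← Finset.prod_range (fun i => 1 - q⁻¹ ^ (r + m - i)), add_comm r m, Finset.prod_range_add]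
    congr 1
    rw [← Finset.prod_range_reflect]
    refine Finset.prod_congr rfl fun i hi => ?_
    have := Finset.mem_range.1 hi
    congr 2
    omega
  have e3 : ∏ a : Fin r, ((resCard R ^ (r - numGt ν (ν (Fin.castAdd m a))) -
      resCard R ^ (r - 1 - (a : ℕ)) : ℕ) : ℂ) =
      (∏ a : Fin r, q ^ (r - numGt ν (ν (Fin.castAdd m a)))) *
        ∏ a : Fin r, (1 - q⁻¹ ^ ((Fin.castAdd m a : ℕ) + 1 - numGt ν (ν (Fin.castAdd m a)))) := by
    rw [← Finset.prod_mul_distrib]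
    refine Finset.prod_congr rfl fun a _ => ?_
    have h1 := hgt a
    have h2 := a.2
    rw [hsub _ _ (by omega), Fin.val_castAdd]
    congr 3
    omega
  have e4 : ∏ i : Fin r, ((resCard R ^ (r + m) - resCard R ^ (i : ℕ) : ℕ) : ℂ) =
      q ^ (r * (r + m)) * ∏ i : Fin r, (1 - q⁻¹ ^ (r + m - (i : ℕ))) := by
    have : q ^ (r * (r + m)) = ∏ i : Fin r, q ^ (r + m) := by
      rw [Finset.prod_const, Finset.card_univ, Fintype.card_fin, ← pow_mul, mul_comm]
    rw [this, ← Finset.prod_mul_distrib]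
    exact Finset.prod_congr rfl fun i _ => hsub _ _ (by omega)
  rw [Nat.cast_mul, Nat.cast_mul, Nat.cast_prod, Nat.cast_prod, e3] at haut
  rw [Nat.cast_mul, Nat.cast_mul, Nat.cast_prod, e4] at hsur
  rw [Nat.cast_mul] at hmul
  simp only [Nat.cast_pow, ← hqdef] at haut hsur
  rw [e1, e2] at hbeta
  have hD : ∏ b : Fin m, (1 - q⁻¹ ^ ((b : ℕ) + 1)) ≠ 0 :=
    Finset.prod_ne_zero_iff.2 fun b _ => hY _ (Nat.succ_pos _)
  have hC : ∏ a : Fin r, (1 - q⁻¹ ^ ((Fin.castAdd m a : ℕ) + 1 -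
      numGt ν (ν (Fin.castAdd m a)))) ≠ 0 :=
    Finset.prod_ne_zero_iff.2 fun a _ => hY _ (by
      have := hgt a
      rw [Fin.val_castAdd]
      omega)
  have hP : ∏ a : Fin r, q ^ (r - numGt ν (ν (Fin.castAdd m a))) ≠ 0 :=
    Finset.prod_ne_zero_iff.2 fun a _ => pow_ne_zero _ hq0
  have haut' := mul_right_cancel₀ hP (haut.trans (by ring :
    _ = q ^ (∑ i, ∑ j, min (ν i) (ν j)) * (∏ a : Fin r, (1 - q⁻¹ ^ ((Fin.castAdd m a : ℕ) + 1 -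
      numGt ν (ν (Fin.castAdd m a))))) * ∏ a : Fin r, q ^ (r - numGt ν (ν (Fin.castAdd m a)))))
  have hsur' := mul_right_cancel₀ (pow_ne_zero (r * (r + m)) hq0) (hsur.trans (by ring :
    _ = q ^ ((r + m) * ∑ j, ν j) * (∏ i : Fin r, (1 - q⁻¹ ^ (r + m - (i : ℕ)))) *
      q ^ (r * (r + m))))
  rw [haut', hsur'] at hmul
  refine mul_right_cancel₀ (mul_ne_zero (pow_ne_zero (∑ i, ∑ j, min (ν i) (ν j)) hq0)
    (mul_ne_zero hC hD)) ?_
  · rw [hbeta]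
    linear_combination (-∏ b : Fin m, (1 - q⁻¹ ^ ((b : ℕ) + 1))) * hmul

/-- Here r is taken to be the number of positive parts, which come first because ν is decreasing. -/
theorem card_isElemDivType {N : ℕ} {ν : Fin N → ℕ} (hν : Antitone ν) :
    (Nat.card {H : Submodule R (Fin N → R) // IsElemDivType H ν} : ℂ) =
      beta ν (resCard R : ℂ) := by
  have hle : numGt ν 0 ≤ N := (Finset.card_le_univ _).trans_eq (Fintype.card_fin N)
  have key := lt_numGt_iff hν 0
  generalize numGt ν 0 = r at hle key
  obtain ⟨m, rfl⟩ := Nat.exists_eq_add_of_le hle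
  refine card_isElemDivType_of_zero_parts hν (fun a => (key _).1 ?_) (fun b => ?_)
  · simp
  · have := mt (key (Fin.natAdd r b)).2 (by simp)
    omega

end TypeCount

/-! ### Products of absolutely convergent series -/

section PiSum

theorem hasSum_pi_prod {h : ℕ} {Y : Fin h → Type*} (f : ∀ i, Y i → ℂ) {a : Fin h → ℂ}
    (hs : ∀ i, Summable fun y => ‖f i y‖) (ha : ∀ i, HasSum (f i) (a i)) :
    (Summable fun y : ∀ i, Y i => ‖∏ i, f i (y i)‖) ∧
      HasSum (fun y : ∀ i, Y i => ∏ i, f i (y i)) (∏ i, a i) := by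
  induction h with
  | zero =>
    refine ⟨Summable.of_finite, ?_⟩
    rw [Finset.univ_eq_empty, Finset.prod_empty]
    simp
  | succ h ih =>
    obtain ⟨h1, h2⟩ := ih (fun i => f i.succ) (fun i => hs i.succ) (fun i => ha i.succ)
    have hsum : Summable fun z : Y 0 × (∀ i : Fin h, Y i.succ) =>
        f 0 z.1 * ∏ i, f i.succ (z.2 i) := by
      apply summable_mul_of_summable_norm (hs 0) h1
    have hn : Summable fun z : Y 0 × (∀ i : Fin h, Y i.succ) =>
        ‖f 0 z.1 * ∏ i, f i.succ (z.2 i)‖ := hsum.norm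
    have hmul := HasSum.mul (ha 0) h2 hsum
    have he : ∀ z : Y 0 × (∀ i : Fin h, Y i.succ),
        ∏ i, f i (Fin.consEquiv Y z i) = f 0 z.1 * ∏ i, f i.succ (z.2 i) := fun z => by
      rw [Fin.prod_univ_succ]
      rfl
    constructor
    · rw [← (Fin.consEquiv Y).summable_iff]
      simpa only [Function.comp_def, he] using hn
    · rw [← (Fin.consEquiv Y).hasSum_iff, Fin.prod_univ_succ]
      simpa only [Function.comp_def, he] using hmul

end PiSum

/-! ### Ramification, inertia and rank -/

section Extension

variable (𝔬 : Type*) [CommRing 𝔬] (𝔓 : Type*) [CommRing 𝔓] [Algebra 𝔬 𝔓] [Module.Finite 𝔬 𝔓]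

theorem liesOver_maximalIdeal [IsLocalRing 𝔬] [IsLocalRing 𝔓] :
    (IsLocalRing.maximalIdeal 𝔓).LiesOver (IsLocalRing.maximalIdeal 𝔬) := by
  have : Algebra.IsIntegral 𝔬 𝔓 := inferInstance
  have h : ((IsLocalRing.maximalIdeal 𝔓).under 𝔬).IsMaximal :=
    Ideal.IsMaximal.under 𝔬 (IsLocalRing.maximalIdeal 𝔓)
  exact ⟨(IsLocalRing.eq_maximalIdeal h).symm⟩

theorem inertDeg_pos [IsLocalRing 𝔓] : 0 < inertDeg 𝔬 𝔓 :=
  Ideal.inertiaDeg_pos _ _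

theorem ramIdx_pos [IsLocalRing 𝔓] : 0 < ramIdx 𝔬 𝔓 :=
  Ideal.ramificationIdx_pos _ _

theorem resCard_eq_pow [IsLocalRing 𝔬] [IsLocalRing 𝔓] :
    resCard 𝔓 = resCard 𝔬 ^ inertDeg 𝔬 𝔓 := by
  have := liesOver_maximalIdeal 𝔬 𝔓
  exact (Ideal.cardQuot_pow_inertiaDeg (IsLocalRing.maximalIdeal 𝔬)
    (IsLocalRing.maximalIdeal 𝔓)).symm

variable [IsDomain 𝔬] [IsDiscreteValuationRing 𝔬]

theorem free_of_finite [IsDomain 𝔓] [FaithfulSMul 𝔬 𝔓] : Module.Free 𝔬 𝔓 := by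
  have : Module.IsTorsionFree 𝔬 𝔓 := inferInstance
  infer_instance

/-- The fundamental identity Σ e f = rank has a single summand: a prime over the maximal ideal is
maximal, and 𝔓 is local. -/
theorem finrank_eq_ramIdx_mul_inertDeg [IsDomain 𝔓] [IsLocalRing 𝔓] [FaithfulSMul 𝔬 𝔓] :
    finrank 𝔬 𝔓 = ramIdx 𝔬 𝔓 * inertDeg 𝔬 𝔓 := by
  have := liesOver_maximalIdeal 𝔬 𝔓
  have := free_of_finite 𝔬 𝔓
  let hu : Unique ((IsLocalRing.maximalIdeal 𝔬).primesOver 𝔓) :=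
    { default := ⟨IsLocalRing.maximalIdeal 𝔓, inferInstance, inferInstance⟩
      uniq := fun P => Subtype.ext (by
        have := P.2.1
        have := P.2.2
        have := Ideal.IsMaximal.of_liesOver_isMaximal P.1 (IsLocalRing.maximalIdeal 𝔬)
        exact IsLocalRing.eq_maximalIdeal this) }
  have h := Ideal.sum_ramification_inertia_eq_finrank (IsLocalRing.maximalIdeal 𝔬) 𝔓
  rw [Fintype.sum_unique] at h
  exact h.symm

theorem finite_residueField_of_finite [IsLocalRing 𝔓] [Finite (IsLocalRing.ResidueField 𝔬)] :
    Finite (IsLocalRing.ResidueField 𝔓) := Nat.finite_of_card_ne_zero (by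
  change resCard 𝔓 ≠ 0
  rw [resCard_eq_pow 𝔬 𝔓]
  exact pow_ne_zero _ (one_lt_resCard 𝔬).ne_bot)

end Extension

/-! ### Projections of sublattices and product endomorphisms -/

section Projection

variable {𝔬 : Type*} [CommRing 𝔬] {h : ℕ} {𝔒 : Fin h → Type*}
  [∀ i, CommRing (𝔒 i)] [∀ i, Algebra 𝔬 (𝔒 i)] {n : Fin h → ℕ}

/-- The `𝔬`-linear endomorphism of `Ω` given by `𝔒_i`-linear endomorphisms of the factors. -/
def piEnd (g : ∀ i, (Fin (n i) → 𝔒 i) →ₗ[𝔒 i] (Fin (n i) → 𝔒 i)) :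
    Omega 𝔒 n →ₗ[𝔬] Omega 𝔒 n :=
  LinearMap.pi fun i => ((g i).restrictScalars 𝔬).comp (LinearMap.proj i)

theorem piEnd_apply (g : ∀ i, (Fin (n i) → 𝔒 i) →ₗ[𝔒 i] (Fin (n i) → 𝔒 i)) (x : Omega 𝔒 n)
    (i : Fin h) : piEnd (𝔬 := 𝔬) g x i = g i (x i) := rfl

theorem piEnd_injective {g : ∀ i, (Fin (n i) → 𝔒 i) →ₗ[𝔒 i] (Fin (n i) → 𝔒 i)}
    (hg : ∀ i, Function.Injective (g i)) : Function.Injective (piEnd (𝔬 := 𝔬) g) :=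
  fun x y hxy => funext fun i => hg i (by rw [← piEnd_apply (𝔬 := 𝔬), hxy, piEnd_apply])

theorem projSpan_map_piEnd (g : ∀ i, (Fin (n i) → 𝔒 i) →ₗ[𝔒 i] (Fin (n i) → 𝔒 i))
    (Λ : Submodule 𝔬 (Omega 𝔒 n)) (i : Fin h) :
    projSpan (Λ.map (piEnd g)) i = (projSpan Λ i).map (g i) := by
  rw [projSpan, projSpan, Submodule.map_span, Submodule.map_coe, Set.image_image, Set.image_image]
  rfl

theorem range_piEnd (g : ∀ i, (Fin (n i) → 𝔒 i) →ₗ[𝔒 i] (Fin (n i) → 𝔒 i)) :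
    LinearMap.range (piEnd (𝔬 := 𝔬) g) =
      Submodule.pi Set.univ fun i => (LinearMap.range (g i)).restrictScalars 𝔬 := by
  ext x
  simp only [LinearMap.mem_range, Submodule.mem_pi, Set.mem_univ, true_implies,
    Submodule.restrictScalars_mem]
  constructor
  · rintro ⟨y, rfl⟩ i
    exact ⟨y i, rfl⟩
  · intro hx
    choose y hy using hx
    exact ⟨y, funext hy⟩

theorem card_quotient_range_piEnd (g : ∀ i, (Fin (n i) → 𝔒 i) →ₗ[𝔒 i] (Fin (n i) → 𝔒 i)) :
    Nat.card (Omega 𝔒 n ⧸ LinearMap.range (piEnd (𝔬 := 𝔬) g)) =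
      ∏ i, Nat.card ((Fin (n i) → 𝔒 i) ⧸ LinearMap.range (g i)) := by
  rw [range_piEnd, Nat.card_congr (Submodule.quotientPi _).toEquiv, Nat.card_pi]
  rfl

theorem mem_projSpan {Λ : Submodule 𝔬 (Omega 𝔒 n)} {x : Omega 𝔒 n} (hx : x ∈ Λ) (i : Fin h) :
    x i ∈ projSpan Λ i := Submodule.subset_span ⟨x, hx, rfl⟩

theorem finite_quotient_projSpan (Λ : Submodule 𝔬 (Omega 𝔒 n)) [Finite (Omega 𝔒 n ⧸ Λ)]
    (i : Fin h) : Finite ((Fin (n i) → 𝔒 i) ⧸ projSpan Λ i) := by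
  let f : Omega 𝔒 n →ₗ[𝔬] ((Fin (n i) → 𝔒 i) ⧸ projSpan Λ i) :=
    ((projSpan Λ i).mkQ.restrictScalars 𝔬).comp (LinearMap.proj i)
  have hf : Λ ≤ LinearMap.ker f := fun x hx =>
    (Submodule.Quotient.mk_eq_zero _).2 (mem_projSpan hx i)
  refine Finite.of_surjective (Λ.liftQ f hf) fun y => ?_
  obtain ⟨y, rfl⟩ := (projSpan Λ i).mkQ_surjective y
  refine ⟨Submodule.Quotient.mk (Function.update 0 i y), ?_⟩
  rw [Submodule.liftQ_apply]
  change (projSpan Λ i).mkQ (Function.update (0 : Omega 𝔒 n) i y i) = _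
  rw [Function.update_self]

/-- The family of the `𝔒_i`-submodules generated by the projections of a sublattice. -/
def projSpans (Λ : FinIndexSubmodule 𝔬 (Omega 𝔒 n)) (i : Fin h) :
    FinIndexSubmodule (𝔒 i) (Fin (n i) → 𝔒 i) :=
  ⟨projSpan Λ.1 i, have := Λ.2; finite_quotient_projSpan Λ.1 i⟩

/-- The sublattices of `Ω` of finite index whose projections generate everything. -/
abbrev FullSublattice (𝔬 : Type*) [CommRing 𝔬] {h : ℕ} (𝔒 : Fin h → Type*)
    [∀ i, CommRing (𝔒 i)] [∀ i, Algebra 𝔬 (𝔒 i)] (n : Fin h → ℕ) : Type _ :=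
  {Λ : FinIndexSubmodule 𝔬 (Omega 𝔒 n) // ∀ i, projSpan Λ.1 i = ⊤}

end Projection

/-! ### Factoring the sum through the projections -/

section Fibres

variable {𝔬 : Type*} [CommRing 𝔬] {h : ℕ} {𝔒 : Fin h → Type*}
  [∀ i, CommRing (𝔒 i)] [∀ i, IsDomain (𝔒 i)] [∀ i, IsDiscreteValuationRing (𝔒 i)]
  [∀ i, Algebra 𝔬 (𝔒 i)] {n : Fin h → ℕ}

theorem exists_injective_range_eq {R : Type*} [CommRing R] [IsDomain R] [IsDiscreteValuationRing R]
    {N : ℕ} (H : FinIndexSubmodule R (Fin N → R)) :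
    ∃ g : (Fin N → R) →ₗ[R] (Fin N → R), Function.Injective g ∧ LinearMap.range g = H.1 := by
  have := H.2
  obtain ⟨e⟩ := exists_linearEquiv_of_finite_quotient R H.1
  refine ⟨H.1.subtype.comp e.toLinearMap, H.1.subtype_injective.comp e.injective, ?_⟩
  rw [LinearMap.range_comp, LinearEquiv.range, Submodule.map_top, Submodule.range_subtype]

/-- The sublattices with given projections correspond to the sublattices whose projections generate
everything, and the index is multiplied by the index of the product of the projections. -/
theorem exists_fiberEquiv (H : ∀ i, FinIndexSubmodule (𝔒 i) (Fin (n i) → 𝔒 i)) :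
    ∃ e : FullSublattice 𝔬 𝔒 n ≃ {Λ : FinIndexSubmodule 𝔬 (Omega 𝔒 n) // projSpans Λ = H},
      ∀ Λ, Nat.card (Omega 𝔒 n ⧸ (e Λ).1.1) =
        Nat.card (Omega 𝔒 n ⧸ Λ.1.1) * ∏ i, Nat.card ((Fin (n i) → 𝔒 i) ⧸ (H i).1) := by
  choose g hg hrange using fun i => exists_injective_range_eq (H i)
  have hG := piEnd_injective (𝔬 := 𝔬) hg
  have hcard : ∀ Λ : Submodule 𝔬 (Omega 𝔒 n), Nat.card (Omega 𝔒 n ⧸ Λ.map (piEnd g)) =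
      Nat.card (Omega 𝔒 n ⧸ Λ) * ∏ i, Nat.card ((Fin (n i) → 𝔒 i) ⧸ (H i).1) := fun Λ => by
    rw [card_quotient_map hG, card_quotient_range_piEnd]
    simp only [hrange]
  have hH : ∏ i, Nat.card ((Fin (n i) → 𝔒 i) ⧸ (H i).1) ≠ 0 :=
    Finset.prod_ne_zero_iff.2 fun i _ => (finite_quotient_iff _).1 (H i).2
  -- Λ lies in the product of the H i, which is the range of `piEnd g`, so no element is lost on
  -- pulling back.
  have hback : ∀ Λ : {Λ : FinIndexSubmodule 𝔬 (Omega 𝔒 n) // projSpans Λ = H},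
      (Λ.1.1.comap (piEnd g)).map (piEnd g) = Λ.1.1 := fun Λ => by
    refine Submodule.map_comap_eq_self ?_
    rw [range_piEnd]
    intro x hx
    rw [Submodule.mem_pi]
    intro i _
    rw [Submodule.restrictScalars_mem, hrange, ← Λ.2]
    exact mem_projSpan hx i
  exact ⟨
    { toFun := fun Λ => ⟨⟨Λ.1.1.map (piEnd g), (finite_quotient_iff _).2 (by
        rw [hcard]
        exact mul_ne_zero ((finite_quotient_iff _).1 Λ.1.2) hH)⟩, by
          ext i : 2
          change projSpan _ i = _
          rw [projSpan_map_piEnd, Λ.2 i, Submodule.map_top, hrange]⟩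
      invFun := fun Λ => ⟨⟨Λ.1.1.comap (piEnd g), (finite_quotient_iff _).2 (by
        have := (finite_quotient_iff _).1 Λ.1.2
        rw [← hback Λ, hcard] at this
        exact left_ne_zero_of_mul this)⟩, fun i => by
          refine Submodule.map_injective_of_injective (hg i) ?_
          have : projSpan Λ.1.1 i = (H i).1 := congrArg Subtype.val (congrFun Λ.2 i)
          rw [← projSpan_map_piEnd, hback Λ, this, Submodule.map_top, hrange]⟩
      left_inv := fun Λ => Subtype.ext (Subtype.ext (Submodule.comap_map_eq_of_injective hG _))
      right_inv := fun Λ => Subtype.ext (Subtype.ext (hback Λ)) },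
    fun Λ => hcard Λ.1.1⟩

theorem natCast_prod_cpow {ι : Type*} (S : Finset ι) (c : ι → ℕ) (z : ℂ) :
    ((∏ i ∈ S, c i : ℕ) : ℂ) ^ z = ∏ i ∈ S, (c i : ℂ) ^ z := by
  classical
  induction S using Finset.induction_on with
  | empty => simp
  | insert a S ha ih =>
    rw [Finset.prod_insert ha, Finset.prod_insert ha, Nat.cast_mul,
      Complex.natCast_mul_natCast_cpow, ih]

/-- The sum over the sublattices whose projections have a given property is the product of the sum
over the projections with the sum over the sublattices whose projections generate everything. -/
theorem hasSum_of_projSpans {s : ℂ}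
    (hs : Summable fun Λ : FinIndexSubmodule 𝔬 (Omega 𝔒 n) => indexTerm s Λ.1)
    (P : (∀ i, FinIndexSubmodule (𝔒 i) (Fin (n i) → 𝔒 i)) → Prop) {a : ℂ}
    (ha : HasSum (fun H : {H // P H} => ∏ i, indexTerm s (H.1 i).1) a) :
    HasSum (fun Λ : {Λ : FinIndexSubmodule 𝔬 (Omega 𝔒 n) // P (projSpans Λ)} => indexTerm s Λ.1.1)
      (a * ∑' Λ : FullSublattice 𝔬 𝔒 n, indexTerm s Λ.1.1) := by
  choose e he using exists_fiberEquiv (𝔬 := 𝔬) (𝔒 := 𝔒) (n := n)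
  -- Every fibre is a copy of the same set of full sublattices, so the disjoint union of the fibres
  -- is a product.
  let E : {H // P H} × FullSublattice 𝔬 𝔒 n ≃
      {Λ : FinIndexSubmodule 𝔬 (Omega 𝔒 n) // P (projSpans Λ)} :=
    ((Equiv.sigmaEquivProd _ _).symm.trans (Equiv.sigmaCongrRight fun H => e H.1)).trans
      { toFun := fun z => ⟨z.2.1, by rw [z.2.2]; exact z.1.2⟩
        invFun := fun Λ => ⟨⟨projSpans Λ.1, Λ.2⟩, ⟨Λ.1, rfl⟩⟩
        left_inv := by
          rintro ⟨⟨H, hH⟩, ⟨Λ, hΛ⟩⟩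
          change projSpans Λ = H at hΛ
          subst hΛ
          rfl
        right_inv := fun _ => rfl }
  have hE : ∀ z, indexTerm s (E z).1.1 = (∏ i, indexTerm s (z.1.1 i).1) * indexTerm s z.2.1.1 := by
    intro z
    have h1 : indexTerm s (E z).1.1 = ((Nat.card (Omega 𝔒 n ⧸ (e z.1.1 z.2).1.1) : ℕ) : ℂ) ^ (-s) :=
      rfl
    rw [h1, he, Nat.cast_mul, Complex.natCast_mul_natCast_cpow, natCast_prod_cpow, mul_comm]
    rfl
  have hsP := (E.summable_iff).2 (hs.subtype {Λ | P (projSpans Λ)})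
  have hsP' : Summable fun z : {H // P H} × FullSublattice 𝔬 𝔒 n =>
      (∏ i, indexTerm s (z.1.1 i).1) * indexTerm s z.2.1.1 := by
    refine hsP.congr fun z => ?_
    exact hE z
  rw [← E.hasSum_iff]
  have hfull : Summable fun Λ : FullSublattice 𝔬 𝔒 n => indexTerm s Λ.1.1 :=
    hs.subtype {Λ | ∀ i, projSpan Λ.1 i = ⊤}
  have hmul := HasSum.mul ha hfull.hasSum hsP'
  simpa only [Function.comp_def, hE] using hmul

end Fibres

/-! ### Sums over submodules of given type and the main theorem -/

section Main

theorem hasSum_isElemDivType {R : Type*} [CommRing R] [IsDomain R] [IsDiscreteValuationRing R]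
    [Finite (IsLocalRing.ResidueField R)] {N : ℕ} {ν : Fin N → ℕ} (hν : Antitone ν) (s : ℂ) :
    (Summable fun H : {H : FinIndexSubmodule R (Fin N → R) // IsElemDivType H.1 ν} =>
      ‖indexTerm s H.1.1‖) ∧
    HasSum (fun H : {H : FinIndexSubmodule R (Fin N → R) // IsElemDivType H.1 ν} =>
      indexTerm s H.1.1) (beta ν (resCard R : ℂ) * ((resCard R : ℂ) ^ (-s)) ^ ∑ j, ν j) := by
  have hcard : ∀ H : Submodule R (Fin N → R), IsElemDivType H ν →
      Nat.card ((Fin N → R) ⧸ H) = resCard R ^ ∑ j, ν j := fun H hH => by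
    obtain ⟨e⟩ := hH.2
    rw [Nat.card_congr e.toEquiv]
    exact card_elemDivModule
  have hfin : ∀ H : Submodule R (Fin N → R), IsElemDivType H ν → Finite ((Fin N → R) ⧸ H) :=
    fun H hH => by
      obtain ⟨e⟩ := hH.2
      exact Finite.of_equiv (ElemDivModule R ν) e.symm.toEquiv
  have hT : Finite {φ : (Fin N → R) →ₗ[R] ElemDivModule R ν // Function.Surjective φ} := by
    have := Finite.of_equiv _ (homEquiv R N (ElemDivModule R ν)).symm
    infer_instance
  -- Every submodule of type ν is the kernel of one of finitely many surjections onto M_ν.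
  have hT' : Finite {H : Submodule R (Fin N → R) // IsElemDivType H ν} := by
    refine Finite.of_surjective (fun φ : {φ : (Fin N → R) →ₗ[R] ElemDivModule R ν //
      Function.Surjective φ} => ⟨LinearMap.ker φ.1, hν,
        ⟨φ.1.quotKerEquivOfSurjective φ.2⟩⟩) ?_
    rintro ⟨H, hH⟩
    obtain ⟨e⟩ := hH.2
    refine ⟨⟨_, ((surjectiveKerEquiv H).symm e).2.1⟩, Subtype.ext ?_⟩
    exact ((surjectiveKerEquiv H).symm e).2.2
  let E : {H : Submodule R (Fin N → R) // IsElemDivType H ν} ≃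
      {H : FinIndexSubmodule R (Fin N → R) // IsElemDivType H.1 ν} :=
    { toFun := fun H => ⟨⟨H.1, hfin H.1 H.2⟩, H.2⟩
      invFun := fun H => ⟨H.1.1, H.2⟩
      left_inv := fun _ => rfl
      right_inv := fun _ => rfl }
  have := Finite.of_equiv _ E
  refine ⟨Summable.of_finite, ?_⟩
  have := Fintype.ofFinite {H : FinIndexSubmodule R (Fin N → R) // IsElemDivType H.1 ν}
  convert! hasSum_fintype _
  rw [← card_isElemDivType hν, Nat.card_congr E, Nat.card_eq_fintype_card, ← nsmul_eq_mul,
    ← Finset.card_univ, ← Finset.sum_const]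
  refine Finset.sum_congr rfl fun H _ => ?_
  rw [indexTerm, hcard H.1.1 H.2, Nat.cast_pow, natCast_pow_cpow]

end Main

end LatticeCount

open LatticeCount in
theorem proposition4p2
    (𝔬 : Type*) [CommRing 𝔬] [IsDomain 𝔬] [IsDiscreteValuationRing 𝔬]
    [IsAdicComplete (IsLocalRing.maximalIdeal 𝔬) 𝔬] [Finite (IsLocalRing.ResidueField 𝔬)]
    (h : ℕ) (𝔒 : Fin h → Type*)
    [∀ i, CommRing (𝔒 i)] [∀ i, IsDomain (𝔒 i)] [∀ i, IsDiscreteValuationRing (𝔒 i)]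
    [∀ i, Algebra 𝔬 (𝔒 i)] [∀ i, FaithfulSMul 𝔬 (𝔒 i)] [∀ i, Module.Finite 𝔬 (𝔒 i)]
    (n : Fin h → ℕ) (N : ℕ) (hN : N = ∑ i, ramIdx 𝔬 (𝔒 i) * inertDeg 𝔬 (𝔒 i) * n i)
    (ν : (i : Fin h) → Fin (n i) → ℕ) (hν : ∀ i, Antitone (ν i))
    (s : ℂ) (hs : (N : ℝ) - 1 < s.re) :
    Summable (fun Λ : FinIndexSubmodule 𝔬 (Fin N → 𝔬) => indexTerm s Λ.1) ∧
    (∀ i, Summable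
      (fun H : FinIndexSubmodule (𝔒 i) (Fin (n i) → 𝔒 i) => indexTerm s H.1)) ∧
    (∀ i, latticeZeta (𝔒 i) (Fin (n i) → 𝔒 i) s ≠ 0) ∧
    HasSum
      (fun Λ : {Λ : FinIndexSubmodule 𝔬 (Omega 𝔒 n) // IsProjectionData Λ.1 ν} =>
        indexTerm s Λ.1.1)
      (latticeZeta 𝔬 (Fin N → 𝔬) s / (∏ i, latticeZeta (𝔒 i) (Fin (n i) → 𝔒 i) s) *
        (∏ i, beta (ν i) ((resCard 𝔬 : ℂ) ^ inertDeg 𝔬 (𝔒 i))) *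
        ((resCard 𝔬 : ℂ) ^ (-s)) ^ (∑ i, (∑ j, ν i j) * inertDeg 𝔬 (𝔒 i))) := by
  have hfin : ∀ i, Finite (IsLocalRing.ResidueField (𝔒 i)) := fun i =>
    finite_residueField_of_finite 𝔬 (𝔒 i)
  have hfree : ∀ i, Module.Free 𝔬 (𝔒 i) := fun i => free_of_finite 𝔬 (𝔒 i)
  -- Since e_i f_i ≥ 1, each n_i is at most N, so s lies in every half-plane of convergence.
  have hsi : ∀ i, (n i : ℝ) - 1 < s.re := fun i => by
    have h1 : n i ≤ N := by
      rw [hN]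
      refine le_trans ?_ (Finset.single_le_sum (fun j _ => Nat.zero_le _) (Finset.mem_univ i))
      exact Nat.le_mul_of_pos_left _ (Nat.mul_pos (ramIdx_pos 𝔬 (𝔒 i)) (inertDeg_pos 𝔬 (𝔒 i)))
    have h2 : (n i : ℝ) ≤ N := by exact_mod_cast h1
    linarith
  have hzo := summable_and_hasSum_indexTerm 𝔬 N hs
  have hzi := fun i => summable_and_hasSum_indexTerm (𝔒 i) (n i) (hsi i)
  have hne : ∀ i, latticeZeta (𝔒 i) (Fin (n i) → 𝔒 i) s ≠ 0 := fun i =>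
    latticeZeta_ne_zero (𝔒 i) (n i) (hsi i)
  refine ⟨hzo.2.summable, fun i => (hzi i).2.summable, hne, ?_⟩
  have hrank : finrank 𝔬 (Omega 𝔒 n) = finrank 𝔬 (Fin N → 𝔬) := by
    rw [finrank_fin_fun, hN, finrank_pi_fintype]
    refine Finset.sum_congr rfl fun i _ => ?_
    rw [finrank_pi_fintype, Finset.sum_const, Finset.card_univ, Fintype.card_fin,
      finrank_eq_ramIdx_mul_inertDeg, smul_eq_mul, mul_comm]
  let e : Omega 𝔒 n ≃ₗ[𝔬] (Fin N → 𝔬) := LinearEquiv.ofFinrankEq _ _ hrank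
  have hΩ : HasSum (fun Λ : FinIndexSubmodule 𝔬 (Omega 𝔒 n) => indexTerm s Λ.1)
      (latticeZeta 𝔬 (Fin N → 𝔬) s) := by
    have h1 : HasSum (fun Λ : FinIndexSubmodule 𝔬 (Fin N → 𝔬) => indexTerm s Λ.1)
      (latticeZeta 𝔬 (Fin N → 𝔬) s) := hzo.2.summable.hasSum
    rw [← (finIndexSubmoduleCongr e).hasSum_iff] at h1
    simpa only [Function.comp_def, indexTerm_finIndexSubmoduleCongr] using h1
  set Z := ∑' Λ : FullSublattice 𝔬 𝔒 n, indexTerm s Λ.1.1 with hZ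
  -- The factorization for the trivial condition, compared with the sum over all sublattices of Ω ≅
  -- 𝔬^N, expresses Z as the quotient of zeta values.
  have hall : latticeZeta 𝔬 (Fin N → 𝔬) s =
      (∏ i, latticeZeta (𝔒 i) (Fin (n i) → 𝔒 i) s) * Z := by
    have h1 := (hasSum_pi_prod
      (fun i (H : FinIndexSubmodule (𝔒 i) (Fin (n i) → 𝔒 i)) => indexTerm s H.1)
      (fun i => (hzi i).1) (fun i => (hzi i).2.summable.hasSum)).2
    let Y := ∀ i, FinIndexSubmodule (𝔒 i) (Fin (n i) → 𝔒 i)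
    let E : {_H : Y // True} ≃ Y := Equiv.subtypeUnivEquiv fun _ => trivial
    have h2 : HasSum (fun H : {_H : Y // True} => ∏ i, indexTerm s (H.1 i).1)
        (∏ i, latticeZeta (𝔒 i) (Fin (n i) → 𝔒 i) s) :=
      (E.hasSum_iff (f := fun H : Y => ∏ i, indexTerm s (H i).1)).2 h1
    have h3 := hasSum_of_projSpans hΩ.summable (fun _ => True) h2
    let F : {_Λ : FinIndexSubmodule 𝔬 (Omega 𝔒 n) // True} ≃ FinIndexSubmodule 𝔬 (Omega 𝔒 n) :=
      Equiv.subtypeUnivEquiv fun _ => trivial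
    have h4 : HasSum (fun Λ : {_Λ : FinIndexSubmodule 𝔬 (Omega 𝔒 n) // True} =>
        indexTerm s Λ.1.1) (latticeZeta 𝔬 (Fin N → 𝔬) s) :=
      (F.hasSum_iff (f := fun Λ : FinIndexSubmodule 𝔬 (Omega 𝔒 n) => indexTerm s Λ.1)).2 hΩ
    exact h4.unique h3
  have hP : HasSum (fun H : {H : ∀ i, FinIndexSubmodule (𝔒 i) (Fin (n i) → 𝔒 i) //
      ∀ i, IsElemDivType (H i).1 (ν i)} => ∏ i, indexTerm s (H.1 i).1)
      (∏ i, beta (ν i) (resCard (𝔒 i) : ℂ) * ((resCard (𝔒 i) : ℂ) ^ (-s)) ^ ∑ j, ν i j) := by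
    have h1 := (hasSum_pi_prod
      (fun i (H : {H : FinIndexSubmodule (𝔒 i) (Fin (n i) → 𝔒 i) // IsElemDivType H.1 (ν i)}) =>
        indexTerm s H.1.1)
      (fun i => (hasSum_isElemDivType (hν i) s).1) (fun i => (hasSum_isElemDivType (hν i) s).2)).2
    let E : {H : ∀ i, FinIndexSubmodule (𝔒 i) (Fin (n i) → 𝔒 i) //
        ∀ i, IsElemDivType (H i).1 (ν i)} ≃
        ∀ i, {H : FinIndexSubmodule (𝔒 i) (Fin (n i) → 𝔒 i) // IsElemDivType H.1 (ν i)} :=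
      { toFun := fun H i => ⟨H.1 i, H.2 i⟩
        invFun := fun H => ⟨fun i => (H i).1, fun i => (H i).2⟩
        left_inv := fun _ => rfl
        right_inv := fun _ => rfl }
    exact (E.hasSum_iff (f := fun H : ∀ i, {H : FinIndexSubmodule (𝔒 i) (Fin (n i) → 𝔒 i) //
      IsElemDivType H.1 (ν i)} => ∏ i, indexTerm s (H i).1.1)).2 h1
  have hmain : HasSum
      (fun Λ : {Λ : FinIndexSubmodule 𝔬 (Omega 𝔒 n) // IsProjectionData Λ.1 ν} =>
        indexTerm s Λ.1.1) _ := hasSum_of_projSpans hΩ.summable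
    (fun H => ∀ i, IsElemDivType (H i).1 (ν i)) hP
  have hval : latticeZeta 𝔬 (Fin N → 𝔬) s / (∏ i, latticeZeta (𝔒 i) (Fin (n i) → 𝔒 i) s) *
        (∏ i, beta (ν i) ((resCard 𝔬 : ℂ) ^ inertDeg 𝔬 (𝔒 i))) *
        ((resCard 𝔬 : ℂ) ^ (-s)) ^ (∑ i, (∑ j, ν i j) * inertDeg 𝔬 (𝔒 i)) =
      (∏ i, beta (ν i) (resCard (𝔒 i) : ℂ) * ((resCard (𝔒 i) : ℂ) ^ (-s)) ^ ∑ j, ν i j) * Z := by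
    rw [hall, mul_div_cancel_left₀ _ (Finset.prod_ne_zero_iff.2 fun i _ => hne i),
      ← Finset.prod_pow_eq_pow_sum, mul_assoc, mul_comm Z, ← Finset.prod_mul_distrib]
    congr 1
    refine Finset.prod_congr rfl fun i _ => ?_
    rw [resCard_eq_pow 𝔬 (𝔒 i), Nat.cast_pow, natCast_pow_cpow, ← pow_mul,
      mul_comm (∑ j, ν i j)]
  rw [hval]
  exact hmain
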